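/- **Setting.** Let $n\ge 1$ and $m,p\ge 0$ be integers. Consider the plant $\dot x=Ax+Bu+w$, $y=Cx+v$ with $x\in\mathbb R^n$, $u\in\mathbb R^m$, $y\in\mathbb R^p$, noise covariances $W\succeq 0$ (of $w$) and $\Sigma\succ 0$ (of $v$), and state and control cost matrices $Q\succeq 0$, $R\succ 0$. Assume that $(A,B)$ and $(A,W^{1/2})$ are controllable and that $(A,C)$ and $(A,Q^{1/2})$ are observable. A full-order controller is $K=(A_K,B_K,C_K)\in\mathcal V:=\mathbb R^{n\times n}\times\mathbb R^{n\times p}\times\mathbb R^{m\times n}$; a tangent vector is $\mathbf V=(E,F,G)\in\mathcal V$. Put $$A_{cl}(K)=\begin{pmatrix}A&BC_K\\B_KC&A_K\end{pmatrix},\quad B_{cl}(K)=\begin{pmatrix}I&0\\0&B_K\end{pmatrix},\quad C_{cl}(K)=\begin{pmatrix}C&0\\0&C_K\end{pmatrix},$$ $$\hat{\mathbf E}(\mathbf V)=\begin{pmatrix}0&BG\\FC&E\end{pmatrix},\quad \hat{\mathbf F}(\mathbf V)=\begin{pmatrix}0&0\\0&F\end{pmatrix},\quad \hat{\mathbf G}(\mathbf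 V)=\begin{pmatrix}0&0\\0&G\end{pmatrix}.$$ Let $\tilde{\mathcal C}_n$ be the set of stabilizing $K$ (i.e. $A_{cl}(K)$ Hurwitz), and $\tilde{\mathcal C}_n^{\min}$ the set of $K\in\tilde{\mathcal C}_n$ with $(A_K,B_K)$ controllable and $(A_K,C_K)$ observable. For Hurwitz $M$ let $\mathbb L(M,N)$ be the unique solution $X$ of $MX+XM^{\top}=-N$. The LQG cost on $\tilde{\mathcal C}_n$ is $$\tilde J(K)=\operatorname{tr}\big(\operatorname{diag}(Q,C_K^{\top}RC_K)\;\mathbb L(A_{cl}(K),\operatorname{diag}(W,B_K\Sigma B_K^{\top}))\big).$$ Let $\mathcal W_c(K)=\mathbb L(A_{cl},B_{cl}B_{cl}^{\top})$ and $\mathcal W_o(K)=\mathbb L(A_{cl}^{\top},C_{cl}^{\top}C_{cl})$ be the closed-loop Grammians, and fix weights $w_1>0$, $w_2,w_3\ge0$. For $K\in\tilde{\mathcal C}_n^{\min}$ let $$\langle\mathbf V_1,\mathbf V_2\rangle_K=w_1\operatorname{tr}[\mathcal W_o\hat{\mathbf E}(\mathbf V_1)\mathcal W_c\hat{\mathbf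 E}(\mathbf V_2)^{\top}]+w_2\operatorname{tr}[\hat{\mathbf F}(\mathbf V_1)^{\top}\mathcal W_o\hat{\mathbf F}(\mathbf V_2)]+w_3\operatorname{tr}[\hat{\mathbf G}(\mathbf V_1)\mathcal W_c\hat{\mathbf G}(\mathbf V_2)^{\top}],$$ with norm $\|\cdot\|_K$. So that this is an inner product, assume that $w_2>0$ or $\operatorname{rank}C=p$, and that $w_3>0$ or $\operatorname{rank}B=m$. Let $\nabla\tilde J(K)$ be the Riemannian gradient for this metric. With $\overline\lambda$ the largest eigenvalue and $\|\cdot\|_2$ the spectral norm, set $$s(K,\mathbf V)=\frac1{2\,\|\hat{\mathbf E}(\mathbf V)\|_2\,\overline\lambda(\mathbb L(A_{cl}(K),I_{2n}))}\in(0,\infty],\quad \sigma(K)=\min_{\|\mathbf V\|_K=1}s(K,\mathbf V),\quad r(K)=\frac{\sigma(K)}{2\,\|\nabla\tilde J(K)\|_K}\in(0,\infty].$$ For invertible $S\in\mathbb R^{n\times n}$ put $\mathcal T_S(K)=(SA_KS^{-1},SB_K,C_KS^{-1})$, which is linear in $K$ and so is its own differential. For a compact set $\mathcal K\subset\tilde{\mathcal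 C}_n^{\min}$ and $\rho:\mathcal K\to[0,\infty]$ put $$\mathcal T_\rho=\{(K,\mathbf V):K\in\mathcal K,\ \|\mathbf V\|_K\le\rho(K)\},\qquad \mathcal T_\rho^*=\{(\mathcal T_S(K),\mathcal T_S(\mathbf V)):(K,\mathbf V)\in\mathcal T_\rho,\ S\in GL(n)\}.$$ **Lemma.** Let $\mathcal K\subset\tilde{\mathcal C}_n^{\min}$ be compact. 1. For $\rho=\tfrac12\sigma$ there is $L>0$ such that for all $(K,\mathbf V)\in\mathcal T_\rho^*$ the controller $K+\mathbf V$ is stabilizing and $$\tilde J(K+\mathbf V)\le\tilde J(K)+\langle\nabla\tilde J(K),\mathbf V\rangle_K+\frac L2\|\mathbf V\|_K^2 .$$ 2. If $r(K)<\sigma(K)$ for every $K\in\mathcal K$ (equivalently, $\|\nabla\tilde J(K)\|_K>\tfrac12$ on $\mathcal K$), the same conclusion holds for $\rho=r$. -/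

import Mathlib

noncomputable section

namespace LQG

open scoped ENNReal Matrix MatrixOrder

/-! ### Linear systems -/

/-- `A` is Hurwitz stable: every complex eigenvalue has negative real part. -/
def Hurwitz {ι : Type*} [Fintype ι] [DecidableEq ι] (A : Matrix ι ι ℝ) : Prop :=
  ∀ z ∈ spectrum ℂ (A.map (algebraMap ℝ ℂ)), z.re < 0

/-- `(A, B)` is controllable: the controllability matrix `[B, AB, …, Aⁿ⁻¹B]` has rank `n`. -/
def Controllable {n : ℕ} {κ : Type*} [Fintype κ]
    (A : Matrix (Fin n) (Fin n) ℝ) (B : Matrix (Fin n) κ ℝ) : Prop :=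
  (Matrix.of fun (i : Fin n) (kj : Fin n × κ) => (A ^ (kj.1 : ℕ) * B) i kj.2).rank = n

/-- `(A, C)` is observable: the observability matrix, with blocks `C, CA, …, CAⁿ⁻¹`,
has rank `n`. -/
def Observable {n : ℕ} {κ : Type*} [Fintype κ]
    (A : Matrix (Fin n) (Fin n) ℝ) (C : Matrix κ (Fin n) ℝ) : Prop :=
  (Matrix.of fun (ki : Fin n × κ) (j : Fin n) => (C * A ^ (ki.1 : ℕ)) ki.2 j).rank = n

open Classical in
/-- The Lyapunov operator `𝕃(A, Q)`: the solution `P` of `A P + P Aᵀ = -Q`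
(it exists and is unique when `A` is Hurwitz). -/
def lyap {ι : Type*} [Fintype ι] (A Q : Matrix ι ι ℝ) : Matrix ι ι ℝ :=
  if h : ∃ P : Matrix ι ι ℝ, A * P + P * Aᵀ = -Q then h.choose else 0

/-- The data of an LQG problem: plant matrices, noise covariances `W`, `V`,
and state and control cost matrices `Q`, `R`. -/
structure Problem (n m p : ℕ) where
  A : Matrix (Fin n) (Fin n) ℝ
  B : Matrix (Fin n) (Fin m) ℝ
  C : Matrix (Fin p) (Fin n) ℝ
  W : Matrix (Fin n) (Fin n) ℝ
  V : Matrix (Fin p) (Fin p) ℝ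
  Q : Matrix (Fin n) (Fin n) ℝ
  R : Matrix (Fin m) (Fin m) ℝ

/-- The standing assumptions on an LQG problem. -/
structure Problem.Standard {n m p : ℕ} (P : Problem n m p) : Prop where
  posSemidef_W : P.W.PosSemidef
  posDef_V : P.V.PosDef
  posSemidef_Q : P.Q.PosSemidef
  posDef_R : P.R.PosDef
  controllable_B : Controllable P.A P.B
  controllable_W : Controllable P.A (CFC.sqrt P.W)
  observable_C : Observable P.A P.C
  observable_Q : Observable P.A (CFC.sqrt P.Q)

/-- The linear space of full-order controllers.  The triple `(A_K, B_K, C_K)` stands for the block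
matrix `[0, C_K; B_K, A_K]`; a tangent vector `[0, G; F, E]` is the triple `(E, F, G)`. -/
abbrev Ctrl (n m p : ℕ) : Type :=
  Matrix (Fin n) (Fin n) ℝ × Matrix (Fin n) (Fin p) ℝ × Matrix (Fin m) (Fin n) ℝ

namespace Ctrl

variable {n m p : ℕ}

/-- The component `A_K` (or `E`). -/
abbrev a (K : Ctrl n m p) : Matrix (Fin n) (Fin n) ℝ := K.1

/-- The component `B_K` (or `F`). -/
abbrev b (K : Ctrl n m p) : Matrix (Fin n) (Fin p) ℝ := K.2.1

/-- The component `C_K` (or `G`). -/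
abbrev c (K : Ctrl n m p) : Matrix (Fin m) (Fin n) ℝ := K.2.2

/-- The coordinate transformation `𝒯_S (A_K, B_K, C_K) = (S A_K S⁻¹, S B_K, C_K S⁻¹)`.
It is linear in `K`, so it is also its own differential. -/
def transform (S : GL (Fin n) ℝ) (K : Ctrl n m p) : Ctrl n m p :=
  ((S : Matrix (Fin n) (Fin n) ℝ) * K.a * ((S⁻¹ : GL (Fin n) ℝ) : Matrix (Fin n) (Fin n) ℝ),
    (S : Matrix (Fin n) (Fin n) ℝ) * K.b,
    K.c * ((S⁻¹ : GL (Fin n) ℝ) : Matrix (Fin n) (Fin n) ℝ))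

end Ctrl

namespace Problem

variable {n m p : ℕ} (P : Problem n m p)

/-! ### The closed loop and the LQG cost -/

/-- Closed-loop system matrix. -/
def Acl (K : Ctrl n m p) : Matrix (Fin n ⊕ Fin n) (Fin n ⊕ Fin n) ℝ :=
  Matrix.fromBlocks P.A (P.B * K.c) (K.b * P.C) K.a

/-- Closed-loop input matrix. -/
def Bcl (K : Ctrl n m p) : Matrix (Fin n ⊕ Fin n) (Fin n ⊕ Fin p) ℝ :=
  Matrix.fromBlocks 1 0 0 K.b

/-- Closed-loop output matrix. -/
def Ccl (K : Ctrl n m p) : Matrix (Fin p ⊕ Fin m) (Fin n ⊕ Fin n) ℝ :=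
  Matrix.fromBlocks P.C 0 0 K.c

def Qcl (K : Ctrl n m p) : Matrix (Fin n ⊕ Fin n) (Fin n ⊕ Fin n) ℝ :=
  Matrix.fromBlocks P.Q 0 0 (K.cᵀ * P.R * K.c)

def Wcl (K : Ctrl n m p) : Matrix (Fin n ⊕ Fin n) (Fin n ⊕ Fin n) ℝ :=
  Matrix.fromBlocks P.W 0 0 (K.b * P.V * K.bᵀ)

/-- The set of stabilizing full-order controllers. -/
def stabilizing : Set (Ctrl n m p) := {K | Hurwitz (P.Acl K)}

/-- The set of minimal (controllable and observable) stabilizing full-order controllers. -/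
def minimal : Set (Ctrl n m p) :=
  {K | K ∈ P.stabilizing ∧ Controllable K.a K.b ∧ Observable K.a K.c}

/-- The LQG cost `J(K) = tr (Q_cl(K) X(K))`, `X(K) = 𝕃(A_cl(K), W_cl(K))`, on `stabilizing`. -/
def cost (K : Ctrl n m p) : ℝ := (P.Qcl K * lyap (P.Acl K) (P.Wcl K)).trace

/-- The differential `dJ_K(V)`, computed along the curve `t ↦ K + t V`. -/
def dcost (K V : Ctrl n m p) : ℝ := deriv (fun t : ℝ => P.cost (K + t • V)) 0

/-! ### The Krishnaprasad–Martin metric -/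

/-- Controllability Grammian of the closed loop. -/
def Wc (K : Ctrl n m p) : Matrix (Fin n ⊕ Fin n) (Fin n ⊕ Fin n) ℝ :=
  lyap (P.Acl K) (Bcl K * (Bcl K)ᵀ)

/-- Observability Grammian of the closed loop. -/
def Wo (K : Ctrl n m p) : Matrix (Fin n ⊕ Fin n) (Fin n ⊕ Fin n) ℝ :=
  lyap (P.Acl K)ᵀ ((P.Ccl K)ᵀ * P.Ccl K)

/-- The differential of `Acl`. -/
def Ehat (V : Ctrl n m p) : Matrix (Fin n ⊕ Fin n) (Fin n ⊕ Fin n) ℝ :=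
  Matrix.fromBlocks 0 (P.B * V.c) (V.b * P.C) V.a

/-- The differential of `Bcl`. -/
def Fhat (V : Ctrl n m p) : Matrix (Fin n ⊕ Fin n) (Fin n ⊕ Fin p) ℝ :=
  Matrix.fromBlocks 0 0 0 V.b

/-- The differential of `Ccl`. -/
def Ghat (V : Ctrl n m p) : Matrix (Fin p ⊕ Fin m) (Fin n ⊕ Fin n) ℝ :=
  Matrix.fromBlocks 0 0 0 V.c

/-- The Krishnaprasad–Martin metric at `K` with weights `w₁, w₂, w₃`. -/
def km (w₁ w₂ w₃ : ℝ) (K V₁ V₂ : Ctrl n m p) : ℝ :=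
  w₁ * (P.Wo K * P.Ehat V₁ * P.Wc K * (P.Ehat V₂)ᵀ).trace
    + w₂ * ((Fhat V₁)ᵀ * P.Wo K * Fhat V₂).trace
    + w₃ * (Ghat V₁ * P.Wc K * (Ghat V₂)ᵀ).trace

/-- The norm `‖V‖_K` of the Krishnaprasad–Martin metric. -/
def kmNorm (w₁ w₂ w₃ : ℝ) (K V : Ctrl n m p) : ℝ := √(P.km w₁ w₂ w₃ K V V)

/-- The coordinates of the metric at `K` in a fixed basis of the space of tangent vectors. -/
def gram (w₁ w₂ w₃ : ℝ) (K : Ctrl n m p) :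
    Matrix (Fin (Module.finrank ℝ (Ctrl n m p))) (Fin (Module.finrank ℝ (Ctrl n m p))) ℝ :=
  Matrix.of fun i j =>
    P.km w₁ w₂ w₃ K (Module.finBasis ℝ (Ctrl n m p) i) (Module.finBasis ℝ (Ctrl n m p) j)

/-- The Riemannian gradient `∇J(K) = ∑ i, ∑ j, Gⁱʲ(K) dJ_K(E_i) E_j`. -/
def grad (w₁ w₂ w₃ : ℝ) (K : Ctrl n m p) : Ctrl n m p :=
  ∑ i, ∑ j, ((P.gram w₁ w₂ w₃ K)⁻¹ i j * P.dcost K (Module.finBasis ℝ (Ctrl n m p) i)) •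
    Module.finBasis ℝ (Ctrl n m p) j

/-! ### Stability certificate and sets of tangent vectors -/

/-- The largest eigenvalue of `𝕃(A_cl(K), I)`. -/
def lambdaMax (K : Ctrl n m p) : ℝ := sSup (spectrum ℝ (lyap (P.Acl K) 1))

/-- The stability certificate `s(K, V) = 1 / (2 ‖dA_cl(V)‖₂ λ_max(𝕃(A_cl(K), I)))`, which is `∞`
when `dA_cl(V) = 0`; `‖·‖₂` is the spectral norm. -/
def cert (K V : Ctrl n m p) : ℝ≥0∞ :=
  (2 * ‖Matrix.toEuclideanCLM (𝕜 := ℝ) (P.Ehat V)‖ₑ * ENNReal.ofReal (P.lambdaMax K))⁻¹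

/-- The certified radius `σ(K)`: the minimum of `s(K, V)` over `‖V‖_K = 1`. -/
def certRadius (w₁ w₂ w₃ : ℝ) (K : Ctrl n m p) : ℝ≥0∞ :=
  ⨅ V : Ctrl n m p, ⨅ _ : P.kmNorm w₁ w₂ w₃ K V = 1, P.cert K V

/-- The gradient-scaled radius `½ ‖∇J(K)‖_K⁻¹ σ(K)`, which is `∞` when `∇J(K) = 0`. -/
def gradRadius (w₁ w₂ w₃ : ℝ) (K : Ctrl n m p) : ℝ≥0∞ :=
  2⁻¹ * (ENNReal.ofReal (P.kmNorm w₁ w₂ w₃ K (P.grad w₁ w₂ w₃ K)))⁻¹ *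
    P.certRadius w₁ w₂ w₃ K

/-- The set `𝒯` of pairs `(K, V)` with `K ∈ 𝒦` and `‖V‖_K ≤ ρ(K)`. -/
def tube (w₁ w₂ w₃ : ℝ) (𝒦 : Set (Ctrl n m p)) (ρ : Ctrl n m p → ℝ≥0∞) :
    Set (Ctrl n m p × Ctrl n m p) :=
  {KV | KV.1 ∈ 𝒦 ∧ ENNReal.ofReal (P.kmNorm w₁ w₂ w₃ KV.1 KV.2) ≤ ρ KV.1}

/-- The set `𝒯*` of all coordinate transforms `(𝒯_S(K), 𝒯_S(V))` of pairs in `𝒯`. -/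
def orbit (T : Set (Ctrl n m p × Ctrl n m p)) : Set (Ctrl n m p × Ctrl n m p) :=
  {KV | ∃ S : GL (Fin n) ℝ, ∃ KV₀ ∈ T, KV = (KV₀.1.transform S, KV₀.2.transform S)}

/-- The Lipschitz-type upper bound for the pair `(K, V)`, with constant `L`.  It includes that
`K + V` is stabilizing, so that `J(K + V)` is defined. -/
def UpperBound (w₁ w₂ w₃ L : ℝ) (K V : Ctrl n m p) : Prop :=
  K + V ∈ P.stabilizing ∧
    P.cost (K + V) ≤ P.cost K + P.km w₁ w₂ w₃ K (P.grad w₁ w₂ w₃ K) V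
      + L / 2 * P.kmNorm w₁ w₂ w₃ K V ^ 2

end Problem

end LQG

end

noncomputable section

namespace LQG

open scoped ENNReal Matrix MatrixOrder Topology
open Filter Matrix

/-! Write `π = ‖lyap A 1‖` for a closed-loop matrix `A`. For symmetric `N`, positivity of the
Lyapunov operator and `-‖N‖ ≤ N ≤ ‖N‖` give `‖lyap A N‖ ≤ π ‖N‖` (`Hurwitz.norm_lyap_le`). If `2 ‖E‖
π ≤ θ < 1`, then `lyap A 1` is still a Lyapunov certificate for `A + E` (`Hurwitz.add`), and
solutions of the perturbed equation grow by at most a factor `1 / (1 - θ)`. The cost is a trace of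
data quadratic in the controller against such a solution, so its Taylor remainder is `O(‖V‖²)`, with
a constant depending only on `θ` and on bounds for `‖K‖`, `‖V‖` and `π`
(`exists_cost_remainder_bound`).

A tangent vector of metric length at most `θ σ(K)` satisfies exactly this smallness condition, by
homogeneity of the certificate (`MetricPos.norm_Ehat_mul_le`). Over the compact set, `K` and `π` are
bounded and the metric dominates a multiple of the square of a fixed norm. The metric is positive
definite because minimality makes both Grammians positive definite. Since `σ` is bounded above
there, `V` is bounded as well, and the remainder is at most a constant times `‖V‖_K²`
(`exists_upperBound`).

Cost, metric and differential are invariant under changes of controller coordinates, so the bound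
passes to the noncompact orbit with the same constant (`UpperBound.transform`). The first radius is
the case `θ = 1/2`. For the second, `r < σ` forces a gradient norm above `1/2`, and compactness
improves this to a uniform `g > 1/2`, so that `θ = 1 / (2g) < 1` works. -/

lemma dotProduct_mulVec_conj {ι κ : Type*} [Fintype ι] [Fintype κ] (M : Matrix ι κ ℝ)
    (X : Matrix κ κ ℝ) (x : ι → ℝ) : x ⬝ᵥ (M * X * Mᵀ) *ᵥ x = (Mᵀ *ᵥ x) ⬝ᵥ X *ᵥ (Mᵀ *ᵥ x) := by
  rw [← Matrix.mulVec_mulVec, ← Matrix.mulVec_mulVec, Matrix.dotProduct_mulVec x M,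
    ← Matrix.mulVec_transpose]

/-! ### Powers of matrices with spectral radius less than one -/

section Powers

variable {ι : Type*} [Fintype ι] [DecidableEq ι]

open scoped Matrix.Norms.L2Operator in
-- Gelfand's formula: `‖M ^ k‖ ^ (1/k)` tends to the spectral radius, so `‖M ^ k‖ ≤ r ^ k`
-- eventually for some `r < 1`.
lemma tendsto_pow_zero_of_spectrum_complex (M : Matrix ι ι ℂ)
    (h : ∀ z ∈ spectrum ℂ M, ‖z‖ < 1) : Tendsto (fun k : ℕ => M ^ k) atTop (𝓝 0) := by
  rcases isEmpty_or_nonempty ι with hι | hι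
  · have : (fun k : ℕ => M ^ k) = fun _ => 0 := by
      funext k; exact Subsingleton.elim _ _
    rw [this]; exact tendsto_const_nhds
  have hr : spectralRadius ℂ M < (1 : NNReal) :=
    spectrum.spectralRadius_lt_of_forall_lt M fun z hz => by
      rw [← NNReal.coe_lt_coe]; simpa using h z hz
  obtain ⟨r, hr1, hr2⟩ := ENNReal.lt_iff_exists_nnreal_btwn.1 hr
  have hr2' : r < 1 := by exact_mod_cast hr2
  have hev := (spectrum.pow_nnnorm_pow_one_div_tendsto_nhds_spectralRadius M).eventually_lt_const hr1
  rw [tendsto_zero_iff_norm_tendsto_zero]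
  refine squeeze_zero' (Eventually.of_forall fun k => norm_nonneg _) ?_
    (tendsto_pow_atTop_nhds_zero_of_lt_one (r := (r : ℝ)) r.2 (by exact_mod_cast hr2'))
  filter_upwards [hev, eventually_gt_atTop 0] with k hk hk0
  have hk' := ENNReal.rpow_le_rpow hk.le (Nat.cast_nonneg k)
  rw [← ENNReal.rpow_mul, one_div, inv_mul_cancel₀ (by positivity), ENNReal.rpow_one,
    ENNReal.rpow_natCast] at hk'
  have : ‖M ^ k‖₊ ≤ r ^ k := by exact_mod_cast hk'
  exact_mod_cast this

lemma tendsto_pow_zero_of_spectrum (M : Matrix ι ι ℝ)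
    (h : ∀ z ∈ spectrum ℂ (M.map (algebraMap ℝ ℂ)), ‖z‖ < 1) :
    Tendsto (fun k : ℕ => M ^ k) atTop (𝓝 0) := by
  have h1 := tendsto_pow_zero_of_spectrum_complex _ h
  have h2 : Continuous fun N : Matrix ι ι ℂ => N.map Complex.re :=
    continuous_id.matrix_map Complex.continuous_re
  have h3 := (h2.tendsto 0).comp h1
  have h4 : (0 : Matrix ι ι ℂ).map Complex.re = 0 := by ext; simp
  rw [h4] at h3
  refine h3.congr fun k => ?_
  have : (M.map (algebraMap ℝ ℂ)) ^ k = (M ^ k).map (algebraMap ℝ ℂ) :=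
    (map_pow (algebraMap ℝ ℂ).mapMatrix M k).symm
  change ((M.map (algebraMap ℝ ℂ)) ^ k).map Complex.re = M ^ k
  rw [this]
  ext i j
  simp

end Powers

/-! ### Hurwitz matrices -/

section Lyapunov

variable {ι : Type*} [Fintype ι] [DecidableEq ι] {A : Matrix ι ι ℝ}

lemma mem_spectrum_iff_exists_mulVec {M : Matrix ι ι ℂ} {z : ℂ} :
    z ∈ spectrum ℂ M ↔ ∃ v ≠ 0, M *ᵥ v = z • v := by
  rw [spectrum.mem_iff, Matrix.isUnit_iff_isUnit_det, isUnit_iff_ne_zero, not_not,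
    ← Matrix.exists_mulVec_eq_zero_iff]
  refine exists_congr fun v => and_congr_right fun _ => ?_
  rw [Matrix.sub_mulVec, sub_eq_zero, Algebra.algebraMap_eq_smul_one, Matrix.smul_mulVec,
    Matrix.one_mulVec, eq_comm]

lemma Hurwitz.transpose (hA : Hurwitz A) : Hurwitz Aᵀ := by
  intro z hz
  refine hA z ?_
  rw [spectrum.mem_iff] at hz ⊢
  rw [← Matrix.isUnit_transpose]
  convert hz using 2
  rw [Matrix.transpose_sub, Algebra.algebraMap_eq_smul_one, Matrix.transpose_smul,
    Matrix.transpose_one, Matrix.transpose_map]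

lemma Hurwitz.isUnit_one_sub (hA : Hurwitz A) : IsUnit (1 - A) := by
  by_contra h
  rw [Matrix.isUnit_iff_isUnit_det, isUnit_iff_ne_zero, not_not] at h
  have h1 : (1 : ℂ) ∈ spectrum ℂ (A.map (algebraMap ℝ ℂ)) := by
    rw [spectrum.mem_iff, Matrix.isUnit_iff_isUnit_det, isUnit_iff_ne_zero, not_not, map_one]
    have : (1 : Matrix ι ι ℂ) - A.map (algebraMap ℝ ℂ) = (algebraMap ℝ ℂ).mapMatrix (1 - A) := by
      rw [map_sub, map_one]; rfl
    rw [this, ← RingHom.map_det, h, map_zero]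
  have := hA 1 h1
  norm_num at this

/-- The Cayley transform of a Hurwitz matrix has spectral radius less than one. -/
lemma Hurwitz.tendsto_cayley_pow (hA : Hurwitz A) :
    Tendsto (fun k : ℕ => ((1 - A)⁻¹ * (1 + A)) ^ k) atTop (𝓝 0) := by
  refine tendsto_pow_zero_of_spectrum _ fun z hz => ?_
  obtain ⟨v, hv, hMv⟩ := mem_spectrum_iff_exists_mulVec.1 hz
  set A' := A.map (algebraMap ℝ ℂ) with hA'
  have h1 : (1 - A') * (((1 - A)⁻¹ * (1 + A)).map (algebraMap ℝ ℂ)) = 1 + A' := by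
    have e1 : (1 : Matrix ι ι ℂ) - A' = (algebraMap ℝ ℂ).mapMatrix (1 - A) := by
      rw [map_sub, map_one]; rfl
    have e2 : (1 : Matrix ι ι ℂ) + A' = (algebraMap ℝ ℂ).mapMatrix (1 + A) := by
      rw [map_add, map_one]; rfl
    rw [e1, e2, ← RingHom.mapMatrix_apply, ← map_mul, ← mul_assoc,
      Matrix.mul_nonsing_inv _ ((Matrix.isUnit_iff_isUnit_det _).1 hA.isUnit_one_sub), one_mul]
  have h2 : (1 + A') *ᵥ v = z • ((1 - A') *ᵥ v) := by
    rw [← h1, ← Matrix.mulVec_mulVec, hMv, Matrix.mulVec_smul]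
  rw [Matrix.add_mulVec, Matrix.sub_mulVec, Matrix.one_mulVec, smul_sub] at h2
  -- An eigenvalue `z` of the Cayley transform comes from the eigenvalue `(z - 1) / (1 + z)` of `A`,
  -- whose real part has the sign of `|z|² - 1`.
  have h3 : (1 + z) • (A' *ᵥ v) = (z - 1) • v := by
    rw [add_smul, one_smul, sub_smul, one_smul]
    linear_combination (exp := 1) h2
  have hz1 : 1 + z ≠ 0 := by
    intro h0
    rw [h0, zero_smul] at h3
    have : z - 1 = -2 := by linear_combination h0
    rw [this] at h3
    exact hv ((smul_eq_zero.1 h3.symm).resolve_left (by norm_num))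
  have h4 : (z - 1) / (1 + z) ∈ spectrum ℂ A' := by
    refine mem_spectrum_iff_exists_mulVec.2 ⟨v, hv, ?_⟩
    rw [div_eq_inv_mul, mul_smul, ← h3, smul_smul, inv_mul_cancel₀ hz1, one_smul]
  have h5 := hA _ h4
  have h6 : ((z - 1) / (1 + z)).re = (Complex.normSq z - 1) / Complex.normSq (1 + z) := by
    rw [Complex.div_re]
    simp only [Complex.normSq_apply, Complex.sub_re, Complex.one_re, Complex.add_re,
      Complex.sub_im, Complex.one_im, Complex.add_im]
    ring
  rw [h6, div_neg_iff] at h5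
  have h7 : 0 < Complex.normSq (1 + z) := Complex.normSq_pos.2 hz1
  have h8 : Complex.normSq z < 1 := by
    rcases h5 with h | h
    · linarith [h.2]
    · linarith [h.1]
  rw [Complex.normSq_eq_norm_sq] at h8
  nlinarith [norm_nonneg z]

/-- The difference of `(1 - A) X (1 - A)ᵀ` and `(1 + A) X (1 + A)ᵀ` is `-2 (A X + X Aᵀ) = 2 N`.
Dividing by `1 - A` on both sides yields a discrete-time equation, which can be iterated in place of
integrating matrix exponentials. -/
lemma Hurwitz.stein (hA : Hurwitz A) {X N : Matrix ι ι ℝ} (h : A * X + X * Aᵀ = -N) :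
    X = ((1 - A)⁻¹ * (1 + A)) * X * ((1 - A)⁻¹ * (1 + A))ᵀ
      + (2 : ℝ) • ((1 - A)⁻¹ * N * ((1 - A)⁻¹)ᵀ) := by
  have hu : (1 - A)⁻¹ * (1 - A) = 1 :=
    Matrix.nonsing_inv_mul _ ((Matrix.isUnit_iff_isUnit_det _).1 hA.isUnit_one_sub)
  set C := (1 - A)⁻¹
  have hu' : (1 - A)ᵀ * Cᵀ = 1 := by rw [← Matrix.transpose_mul, hu, Matrix.transpose_one]
  have h1 : (1 - A) * X * (1 - A)ᵀ = (1 + A) * X * (1 + A)ᵀ + (2 : ℝ) • N := by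
    rw [← neg_eq_iff_eq_neg.2 h]
    simp only [Matrix.transpose_sub, Matrix.transpose_add, Matrix.transpose_one, two_smul]
    noncomm_ring
  calc X = (C * (1 - A)) * X * ((1 - A)ᵀ * Cᵀ) := by rw [hu, hu', one_mul, mul_one]
    _ = C * ((1 - A) * X * (1 - A)ᵀ) * Cᵀ := by noncomm_ring
    _ = _ := by
      rw [h1, Matrix.transpose_mul]
      simp only [mul_add, add_mul, Matrix.mul_smul, Matrix.smul_mul, mul_assoc]

lemma Hurwitz.eq_zero_of_lyapunov (hA : Hurwitz A) {X : Matrix ι ι ℝ}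
    (h : A * X + X * Aᵀ = 0) : X = 0 := by
  have h1 := hA.stein (N := 0) (by rw [h, neg_zero])
  simp only [mul_zero, zero_mul, smul_zero, add_zero] at h1
  have hM := hA.tendsto_cayley_pow
  set M := (1 - A)⁻¹ * (1 + A)
  have h2 : ∀ k : ℕ, M ^ k * X * (M ^ k)ᵀ = X := by
    intro k
    induction k with
    | zero => simp
    | succ k ih =>
      rw [pow_succ, Matrix.transpose_mul]
      calc M ^ k * M * X * (Mᵀ * (M ^ k)ᵀ) = M ^ k * (M * X * Mᵀ) * (M ^ k)ᵀ := by noncomm_ring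
        _ = X := by rw [← h1, ih]
  have h3 : Tendsto (fun k : ℕ => M ^ k * X * (M ^ k)ᵀ) atTop (𝓝 (0 * X * 0ᵀ)) := by
    have hc : Continuous fun Z : Matrix ι ι ℝ => Z * X * Zᵀ := by fun_prop
    exact (hc.tendsto 0).comp hM
  simp only [h2, zero_mul] at h3
  exact tendsto_nhds_unique tendsto_const_nhds h3

/-- Along the iterates of the discrete equation the form of `M ^ k X (M ^ k)ᵀ` at `x` decreases and
tends to zero, so its value at `k = 0` is nonnegative. -/
lemma Hurwitz.dotProduct_mulVec_nonneg (hA : Hurwitz A) {X N : Matrix ι ι ℝ}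
    (h : A * X + X * Aᵀ = -N) (hN : ∀ x, 0 ≤ x ⬝ᵥ N *ᵥ x) (x : ι → ℝ) : 0 ≤ x ⬝ᵥ X *ᵥ x := by
  have h1 := hA.stein h
  have hM := hA.tendsto_cayley_pow
  set M := (1 - A)⁻¹ * (1 + A)
  have h2 : Antitone fun k : ℕ => x ⬝ᵥ (M ^ k * X * (M ^ k)ᵀ) *ᵥ x := by
    refine antitone_nat_of_succ_le fun k => ?_
    have e : M ^ (k + 1) * X * (M ^ (k + 1))ᵀ = M ^ k * (M * X * Mᵀ) * (M ^ k)ᵀ := by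
      rw [pow_succ, Matrix.transpose_mul]; noncomm_ring
    rw [e, dotProduct_mulVec_conj, dotProduct_mulVec_conj (M ^ k)]
    set y := (M ^ k)ᵀ *ᵥ x
    conv_rhs => rw [h1, Matrix.add_mulVec, Matrix.smul_mulVec, dotProduct_add, dotProduct_smul,
      dotProduct_mulVec_conj (1 - A)⁻¹, smul_eq_mul]
    linarith [hN (((1 - A)⁻¹)ᵀ *ᵥ y)]
  have h3 : Tendsto (fun k : ℕ => x ⬝ᵥ (M ^ k * X * (M ^ k)ᵀ) *ᵥ x) atTop
      (𝓝 (x ⬝ᵥ (0 * X * 0ᵀ) *ᵥ x)) := by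
    have hc : Continuous fun Z : Matrix ι ι ℝ => x ⬝ᵥ (Z * X * Zᵀ) *ᵥ x := by fun_prop
    exact (hc.tendsto 0).comp hM
  have h4 := h2.le_of_tendsto h3 0
  simpa using h4

/-! ### The Lyapunov operator at a Hurwitz matrix -/

lemma Hurwitz.lyap_spec (hA : Hurwitz A) (N : Matrix ι ι ℝ) :
    A * lyap A N + lyap A N * Aᵀ = -N := by
  have hex : ∃ P : Matrix ι ι ℝ, A * P + P * Aᵀ = -N := by
    let f : Matrix ι ι ℝ →ₗ[ℝ] Matrix ι ι ℝ :=
      LinearMap.mulLeft ℝ A + LinearMap.mulRight ℝ Aᵀ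
    have hf : Function.Injective f := by
      rw [injective_iff_map_eq_zero]
      intro X hX
      exact hA.eq_zero_of_lyapunov hX
    -- Uniqueness implies existence in finite dimension.
    exact (LinearMap.injective_iff_surjective.1 hf) (-N)
  rw [lyap, dif_pos hex]
  exact hex.choose_spec

/-- As `lyap` is a choice of solution, identities about it are proved by checking the equation and
appealing to uniqueness. -/
lemma Hurwitz.lyap_eq (hA : Hurwitz A) {X N : Matrix ι ι ℝ} (h : A * X + X * Aᵀ = -N) :
    lyap A N = X := by
  have h1 := hA.lyap_spec N
  refine sub_eq_zero.1 (hA.eq_zero_of_lyapunov ?_)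
  rw [mul_sub, sub_mul, ← sub_eq_zero.2 (h1.trans h.symm)]
  abel

lemma Hurwitz.lyap_add (hA : Hurwitz A) (M N : Matrix ι ι ℝ) :
    lyap A (M + N) = lyap A M + lyap A N := by
  refine hA.lyap_eq ?_
  rw [mul_add, add_mul, neg_add, ← hA.lyap_spec M, ← hA.lyap_spec N]
  abel

lemma Hurwitz.lyap_smul (hA : Hurwitz A) (c : ℝ) (N : Matrix ι ι ℝ) :
    lyap A (c • N) = c • lyap A N := by
  refine hA.lyap_eq ?_
  rw [Matrix.mul_smul, Matrix.smul_mul, ← smul_add, hA.lyap_spec, smul_neg]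

lemma Hurwitz.lyap_sub (hA : Hurwitz A) (M N : Matrix ι ι ℝ) :
    lyap A (M - N) = lyap A M - lyap A N := by
  rw [eq_sub_iff_add_eq, ← hA.lyap_add, sub_add_cancel]

lemma Hurwitz.lyap_isSymm (hA : Hurwitz A) {N : Matrix ι ι ℝ} (hN : N.IsSymm) :
    (lyap A N).IsSymm := by
  refine (hA.lyap_eq ?_).symm
  have := congrArg Matrix.transpose (hA.lyap_spec N)
  rw [Matrix.transpose_add, Matrix.transpose_mul, Matrix.transpose_mul, Matrix.transpose_neg,
    Matrix.transpose_transpose, hN.eq] at this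
  rw [← this, add_comm]

lemma Hurwitz.lyap_posSemidef (hA : Hurwitz A) {N : Matrix ι ι ℝ} (hN : N.PosSemidef) :
    (lyap A N).PosSemidef := by
  have hs : N.IsSymm := by simpa [Matrix.IsSymm] using hN.isHermitian.eq
  refine .of_dotProduct_mulVec_nonneg ?_ fun x => ?_
  · have := hA.lyap_isSymm hs
    simpa [Matrix.IsHermitian] using this.eq
  · simpa using hA.dotProduct_mulVec_nonneg (hA.lyap_spec N)
      (fun x => by simpa using hN.dotProduct_mulVec_nonneg x) x

/-- Split an eigenvector of `Aᵀ` into real and imaginary parts `a`, `b`. The negative form summed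
over `a` and `b` equals `2 Re z` times a nonnegative number, which forces `Re z < 0`. -/
lemma hurwitz_of_lyapunov {P : Matrix ι ι ℝ} (hP : P.PosSemidef)
    (h : ∀ x ≠ 0, x ⬝ᵥ (A * P + P * Aᵀ) *ᵥ x < 0) : Hurwitz A := by
  have hPs : Pᵀ = P := by simpa using hP.isHermitian.eq
  have hq : ∀ x, x ⬝ᵥ (A * P + P * Aᵀ) *ᵥ x = 2 * ((Aᵀ *ᵥ x) ⬝ᵥ P *ᵥ x) := by
    intro x
    rw [Matrix.add_mulVec, dotProduct_add, ← Matrix.mulVec_mulVec, ← Matrix.mulVec_mulVec,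
      Matrix.dotProduct_mulVec x A, ← Matrix.mulVec_transpose, Matrix.dotProduct_mulVec x P,
      ← Matrix.mulVec_transpose P, hPs, dotProduct_comm (P *ᵥ x)]
    ring
  have hle : ∀ x, x ⬝ᵥ (A * P + P * Aᵀ) *ᵥ x ≤ 0 := by
    intro x
    rcases eq_or_ne x 0 with rfl | hx
    · simp
    · exact (h x hx).le
  intro z hz
  have hz' : z ∈ spectrum ℂ (Aᵀ.map (algebraMap ℝ ℂ)) := by
    rw [spectrum.mem_iff] at hz ⊢
    rw [← Matrix.isUnit_transpose]
    convert hz using 2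
    rw [Matrix.transpose_sub, Algebra.algebraMap_eq_smul_one, Matrix.transpose_smul,
      Matrix.transpose_one, Matrix.transpose_map, Matrix.transpose_transpose]
  obtain ⟨v, hv, hAv⟩ := mem_spectrum_iff_exists_mulVec.1 hz'
  set a : ι → ℝ := fun i => (v i).re with ha
  set b : ι → ℝ := fun i => (v i).im with hb
  have hAa : Aᵀ *ᵥ a = z.re • a - z.im • b := by
    ext i
    have := congrArg Complex.re (congrFun hAv i)
    simpa [Matrix.mulVec, dotProduct, ha, hb] using this
  have hAb : Aᵀ *ᵥ b = z.re • b + z.im • a := by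
    ext i
    have := congrArg Complex.im (congrFun hAv i)
    simpa [Matrix.mulVec, dotProduct, ha, hb] using this
  have hsym : b ⬝ᵥ P *ᵥ a = a ⬝ᵥ P *ᵥ b := by
    rw [Matrix.dotProduct_mulVec, ← Matrix.mulVec_transpose, hPs, dotProduct_comm]
  have hsum : a ⬝ᵥ (A * P + P * Aᵀ) *ᵥ a + b ⬝ᵥ (A * P + P * Aᵀ) *ᵥ b
      = 2 * z.re * (a ⬝ᵥ P *ᵥ a + b ⬝ᵥ P *ᵥ b) := by
    rw [hq, hq, hAa, hAb]
    simp only [sub_dotProduct, add_dotProduct, smul_dotProduct, smul_eq_mul, hsym]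
    ring
  have hneg : a ⬝ᵥ (A * P + P * Aᵀ) *ᵥ a + b ⬝ᵥ (A * P + P * Aᵀ) *ᵥ b < 0 := by
    by_cases ha0 : a = 0
    · have hb0 : b ≠ 0 := by
        rintro hb0
        refine hv (funext fun i => Complex.ext ?_ ?_)
        · exact congrFun ha0 i
        · exact congrFun hb0 i
      linarith [hle a, h b hb0]
    · linarith [hle b, h a ha0]
  have hPa : 0 ≤ a ⬝ᵥ P *ᵥ a := by simpa using hP.dotProduct_mulVec_nonneg a
  have hPb : 0 ≤ b ⬝ᵥ P *ᵥ b := by simpa using hP.dotProduct_mulVec_nonneg b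
  by_contra hcon
  push Not at hcon
  nlinarith [mul_nonneg hcon (add_nonneg hPa hPb)]

/-- A vector in the kernel of a controllability Grammian is sent to the kernel by `Aᵀ`. -/
lemma Hurwitz.mulVec_transpose_of_lyap_mulVec_eq_zero {κ : Type*} [Fintype κ] (hA : Hurwitz A)
    (B : Matrix ι κ ℝ) {x : ι → ℝ} (hx : lyap A (B * Bᵀ) *ᵥ x = 0) :
    Bᵀ *ᵥ x = 0 ∧ lyap A (B * Bᵀ) *ᵥ (Aᵀ *ᵥ x) = 0 := by
  have h := hA.lyap_spec (B * Bᵀ)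
  have hs := hA.lyap_isSymm (N := B * Bᵀ) (by
    rw [Matrix.IsSymm, Matrix.transpose_mul, Matrix.transpose_transpose])
  set X := lyap A (B * Bᵀ)
  have h1 : X *ᵥ (Aᵀ *ᵥ x) = -(B *ᵥ (Bᵀ *ᵥ x)) := by
    have := congrArg (· *ᵥ x) h
    simpa [Matrix.add_mulVec, ← Matrix.mulVec_mulVec, hx, Matrix.neg_mulVec] using this
  have h2 : (Bᵀ *ᵥ x) ⬝ᵥ (Bᵀ *ᵥ x) = 0 := by
    have h3 : x ⬝ᵥ X *ᵥ (Aᵀ *ᵥ x) = 0 := by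
      rw [Matrix.dotProduct_mulVec, ← Matrix.mulVec_transpose, hs.eq, hx, zero_dotProduct]
    rw [h1, dotProduct_neg, neg_eq_zero, Matrix.dotProduct_mulVec, ← Matrix.mulVec_transpose] at h3
    exact h3
  have h3 : Bᵀ *ᵥ x = 0 := dotProduct_self_eq_zero.1 h2
  exact ⟨h3, by rw [h1, h3, Matrix.mulVec_zero, neg_zero]⟩

end Lyapunov

/-! ### Spectral norm estimates for the Lyapunov operator -/

section NormEstimates

open scoped Matrix.Norms.L2Operator

lemma dotProduct_self_eq_norm_sq {ι : Type*} [Fintype ι] (x : ι → ℝ) :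
    x ⬝ᵥ x = ‖WithLp.toLp 2 x‖ ^ 2 := by
  rw [EuclideanSpace.real_norm_sq_eq]
  simp [dotProduct, sq]

lemma isSymm_mul_add_mul_transpose {ι : Type*} [Fintype ι] (E : Matrix ι ι ℝ)
    {X : Matrix ι ι ℝ} (hX : X.IsSymm) :
    (E * X + X * Eᵀ).IsSymm := by
  rw [Matrix.IsSymm, Matrix.transpose_add, Matrix.transpose_mul, Matrix.transpose_mul,
    Matrix.transpose_transpose, hX.eq, add_comm]

variable {ι : Type*} [Fintype ι] [DecidableEq ι] {A E : Matrix ι ι ℝ}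

lemma abs_dotProduct_mulVec_le (N : Matrix ι ι ℝ) (x : ι → ℝ) :
    |x ⬝ᵥ N *ᵥ x| ≤ ‖N‖ * (x ⬝ᵥ x) := by
  have h := Matrix.inner_toEuclideanCLM N (WithLp.toLp 2 x) (WithLp.toLp 2 x)
  rw [← h, dotProduct_self_eq_norm_sq]
  refine (abs_real_inner_le_norm _ _).trans ?_
  have h2 := (Matrix.toEuclideanCLM (𝕜 := ℝ) N).le_opNorm (WithLp.toLp 2 x)
  rw [Matrix.l2_opNorm_toEuclideanCLM] at h2
  nlinarith [norm_nonneg (WithLp.toLp 2 x)]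

lemma norm_le_of_abs_dotProduct_mulVec_le {X : Matrix ι ι ℝ} (hX : X.IsSymm) {c : ℝ} (hc : 0 ≤ c)
    (h : ∀ x, |x ⬝ᵥ X *ᵥ x| ≤ c * (x ⬝ᵥ x)) : ‖X‖ ≤ c := by
  have hsym : (Matrix.toEuclideanCLM (𝕜 := ℝ) X).IsSymmetric := by
    intro x y
    change inner ℝ (Matrix.toEuclideanCLM (𝕜 := ℝ) X x) y
      = inner ℝ x (Matrix.toEuclideanCLM (𝕜 := ℝ) X y)
    rw [real_inner_comm, Matrix.inner_toEuclideanCLM, Matrix.inner_toEuclideanCLM,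
      Matrix.dotProduct_mulVec, ← Matrix.mulVec_transpose, hX.eq, dotProduct_comm]
  rw [← Matrix.l2_opNorm_toEuclideanCLM, ContinuousLinearMap.norm_eq_iSup_rayleighQuotient _ hsym]
  refine ciSup_le fun x => ?_
  rw [ContinuousLinearMap.rayleighQuotient, ContinuousLinearMap.reApplyInnerSelf_apply, abs_div,
    abs_of_nonneg (sq_nonneg ‖x‖)]
  refine div_le_of_le_mul₀ (sq_nonneg _) hc ?_
  have h1 := h x.ofLp
  rw [dotProduct_self_eq_norm_sq, ← Matrix.inner_toEuclideanCLM, real_inner_comm] at h1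
  exact h1

lemma norm_transpose_eq {κ : Type*} [Fintype κ] [DecidableEq κ] (M : Matrix ι κ ℝ) :
    ‖Mᵀ‖ = ‖M‖ := by
  simpa using Matrix.l2_opNorm_conjTranspose M

lemma abs_trace_le (M : Matrix ι ι ℝ) : |M.trace| ≤ Fintype.card ι * ‖M‖ := by
  have h : ∀ i, |M i i| ≤ ‖M‖ := by
    intro i
    simpa using abs_dotProduct_mulVec_le M (Pi.single i 1)
  calc |M.trace| ≤ ∑ i, |M i i| := Finset.abs_sum_le_sum_abs _ _
    _ ≤ ∑ _i : ι, ‖M‖ := Finset.sum_le_sum fun i _ => h i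
    _ = _ := by simp

lemma abs_trace_mul_le (M N : Matrix ι ι ℝ) :
    |(M * N).trace| ≤ Fintype.card ι * (‖M‖ * ‖N‖) :=
  (abs_trace_le _).trans (by gcongr; exact norm_mul_le _ _)

lemma norm_mul_add_mul_transpose_le (E X : Matrix ι ι ℝ) :
    ‖E * X + X * Eᵀ‖ ≤ 2 * ‖E‖ * ‖X‖ := by
  calc ‖E * X + X * Eᵀ‖ ≤ ‖E * X‖ + ‖X * Eᵀ‖ := norm_add_le _ _
    _ ≤ ‖E‖ * ‖X‖ + ‖X‖ * ‖Eᵀ‖ := add_le_add (norm_mul_le _ _) (norm_mul_le _ _)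
    _ = _ := by rw [norm_transpose_eq]; ring

/-- Positivity of `lyap A` applied to `‖N‖ • 1 ± N` bounds the quadratic form of `lyap A N` by `‖N‖`
times that of `lyap A 1`; for symmetric matrices the quadratic form controls the norm. -/
lemma Hurwitz.norm_lyap_le (hA : Hurwitz A) {N : Matrix ι ι ℝ} (hN : N.IsSymm) :
    ‖lyap A N‖ ≤ ‖lyap A 1‖ * ‖N‖ := by
  refine norm_le_of_abs_dotProduct_mulVec_le (hA.lyap_isSymm hN) (by positivity) fun x => ?_
  have h1 : ∀ x : ι → ℝ, 0 ≤ x ⬝ᵥ (‖N‖ • (1 : Matrix ι ι ℝ) - N) *ᵥ x := by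
    intro x
    rw [Matrix.sub_mulVec, Matrix.smul_mulVec, Matrix.one_mulVec, dotProduct_sub, dotProduct_smul,
      smul_eq_mul]
    linarith [le_abs_self (x ⬝ᵥ N *ᵥ x), abs_dotProduct_mulVec_le N x]
  have h2 : ∀ x : ι → ℝ, 0 ≤ x ⬝ᵥ (‖N‖ • (1 : Matrix ι ι ℝ) + N) *ᵥ x := by
    intro x
    rw [Matrix.add_mulVec, Matrix.smul_mulVec, Matrix.one_mulVec, dotProduct_add, dotProduct_smul,
      smul_eq_mul]
    linarith [neg_abs_le (x ⬝ᵥ N *ᵥ x), abs_dotProduct_mulVec_le N x]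
  have h3 := hA.dotProduct_mulVec_nonneg (hA.lyap_spec _) h1 x
  have h4 := hA.dotProduct_mulVec_nonneg (hA.lyap_spec _) h2 x
  rw [hA.lyap_sub, hA.lyap_smul, Matrix.sub_mulVec, Matrix.smul_mulVec, dotProduct_sub,
    dotProduct_smul, smul_eq_mul] at h3
  rw [hA.lyap_add, hA.lyap_smul, Matrix.add_mulVec, Matrix.smul_mulVec, dotProduct_add,
    dotProduct_smul, smul_eq_mul] at h4
  have h5 := (le_abs_self _).trans (abs_dotProduct_mulVec_le (lyap A 1) x)
  have h6 := mul_le_mul_of_nonneg_left h5 (norm_nonneg N)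
  rw [abs_le]
  constructor <;> linarith

lemma sSup_spectrum_eq_norm [Nonempty ι] {X : Matrix ι ι ℝ} (hX : X.PosSemidef) :
    sSup (spectrum ℝ X) = ‖X‖ := by
  have hbdd : ∀ z ∈ spectrum ℝ X, z ≤ ‖X‖ := fun z hz =>
    (le_abs_self z).trans (by simpa using spectrum.norm_le_norm_of_mem hz)
  have hXs : X.IsSymm := by simpa [Matrix.IsSymm] using hX.isHermitian.eq
  have hne : (spectrum ℝ X).Nonempty := by
    rw [hX.isHermitian.spectrum_real_eq_range_eigenvalues]
    exact Set.range_nonempty _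
  have hnn : 0 ≤ sSup (spectrum ℝ X) := by
    refine Real.sSup_nonneg fun z hz => ?_
    rw [hX.isHermitian.spectrum_real_eq_range_eigenvalues] at hz
    obtain ⟨i, rfl⟩ := hz
    exact hX.eigenvalues_nonneg i
  refine le_antisymm (csSup_le hne hbdd) (norm_le_of_abs_dotProduct_mulVec_le hXs hnn fun x => ?_)
  have h1 : X ≤ algebraMap ℝ (Matrix ι ι ℝ) (sSup (spectrum ℝ X)) :=
    le_algebraMap_of_spectrum_le (fun z hz => le_csSup ⟨_, hbdd⟩ hz)
      (ha := hX.isHermitian.isSelfAdjoint)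
  have h2 := (Matrix.le_iff.1 h1).dotProduct_mulVec_nonneg x
  have h3 := hX.dotProduct_mulVec_nonneg x
  rw [Algebra.algebraMap_eq_smul_one, Matrix.sub_mulVec, Matrix.smul_mulVec, Matrix.one_mulVec,
    dotProduct_sub, dotProduct_smul, smul_eq_mul, star_trivial] at h2
  rw [star_trivial] at h3
  rw [abs_of_nonneg h3]
  linarith

/-- With `X = lyap A 1`, the Lyapunov expression of `A + E` at `X` is `-1 + (E X + X Eᵀ)`, and the
perturbation has norm below one. -/
lemma Hurwitz.add (hA : Hurwitz A) (hE : 2 * ‖E‖ * ‖lyap A 1‖ < 1) : Hurwitz (A + E) := by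
  refine hurwitz_of_lyapunov (hA.lyap_posSemidef Matrix.PosSemidef.one) fun x hx => ?_
  have h1 := hA.lyap_spec 1
  set X := lyap A 1
  have h2 : (A + E) * X + X * (A + E)ᵀ = (E * X + X * Eᵀ) - 1 := by
    rw [sub_eq_add_neg, ← h1, Matrix.transpose_add]
    noncomm_ring
  rw [h2, Matrix.sub_mulVec, Matrix.one_mulVec, dotProduct_sub]
  have h3 := (le_abs_self _).trans (abs_dotProduct_mulVec_le (E * X + X * Eᵀ) x)
  have h4 : 0 < x ⬝ᵥ x := by
    rw [dotProduct_self_eq_norm_sq]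
    have : WithLp.toLp 2 x ≠ 0 := by simpa using hx
    positivity
  have h5 := mul_lt_mul_of_pos_right ((norm_mul_add_mul_transpose_le E X).trans_lt hE) h4
  linarith

/-- A resolvent-type identity: moving `E` to the right-hand side turns the perturbed equation into
one for `A`. -/
lemma Hurwitz.lyap_add_eq (hA : Hurwitz A) (hAE : Hurwitz (A + E)) (N N' : Matrix ι ι ℝ) :
    lyap (A + E) N' - lyap A N
      = lyap A (N' - N + (E * lyap (A + E) N' + lyap (A + E) N' * Eᵀ)) := by
  refine (hA.lyap_eq ?_).symm
  have h1 := hAE.lyap_spec N'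
  have h2 := hA.lyap_spec N
  generalize lyap (A + E) N' = X' at h1 ⊢
  generalize lyap A N = X at h2 ⊢
  rw [neg_add, neg_sub, ← neg_eq_iff_eq_neg.2 h1, ← neg_eq_iff_eq_neg.2 h2, Matrix.transpose_add]
  noncomm_ring

/-- An absorption argument: the identity above with zero reference source bounds the norm by `π ‖N‖`
plus `θ` times itself. -/
lemma Hurwitz.norm_lyap_add_le (hA : Hurwitz A) {θ : ℝ} (hθ : θ < 1)
    (hE : 2 * ‖E‖ * ‖lyap A 1‖ ≤ θ) {N : Matrix ι ι ℝ} (hN : N.IsSymm) :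
    ‖lyap (A + E) N‖ ≤ ‖lyap A 1‖ * ‖N‖ / (1 - θ) := by
  have hAE := hA.add (hE.trans_lt hθ)
  have h1 := hA.lyap_add_eq hAE 0 N
  have h0 : lyap A (0 : Matrix ι ι ℝ) = 0 := hA.lyap_eq (by simp)
  rw [h0, sub_zero, sub_zero] at h1
  have h2 := hA.norm_lyap_le (hN.add (isSymm_mul_add_mul_transpose E (hAE.lyap_isSymm hN)))
  rw [← h1] at h2
  have h3 := norm_add_le N (E * lyap (A + E) N + lyap (A + E) N * Eᵀ)
  have h4 := norm_mul_add_mul_transpose_le E (lyap (A + E) N)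
  have h5 := mul_le_mul_of_nonneg_right hE (norm_nonneg (lyap (A + E) N))
  have h6 := mul_le_mul_of_nonneg_left (h3.trans (add_le_add_right h4 _)) (norm_nonneg (lyap A 1))
  rw [le_div_iff₀ (by linarith)]
  nlinarith

lemma Hurwitz.norm_lyap_add_sub_le (hA : Hurwitz A) {θ : ℝ} (hθ : θ < 1)
    (hE : 2 * ‖E‖ * ‖lyap A 1‖ ≤ θ) {N N' : Matrix ι ι ℝ} (hN : N.IsSymm) (hN' : N'.IsSymm) :
    ‖lyap (A + E) N' - lyap A N‖
      ≤ ‖lyap A 1‖ * (‖N' - N‖ + 2 * ‖E‖ * ‖lyap (A + E) N'‖) := by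
  have hAE := hA.add (hE.trans_lt hθ)
  rw [hA.lyap_add_eq hAE]
  refine (hA.norm_lyap_le
    ((hN'.sub hN).add (isSymm_mul_add_mul_transpose E (hAE.lyap_isSymm hN')))).trans ?_
  gcongr
  exact (norm_add_le _ _).trans (add_le_add_right (norm_mul_add_mul_transpose_le _ _) _)

lemma Hurwitz.tendsto_lyap (hA : Hurwitz A) {α : Type*} {l : Filter α} {f g : α → Matrix ι ι ℝ}
    {N : Matrix ι ι ℝ} (hf : Tendsto f l (𝓝 A)) (hg : Tendsto g l (𝓝 N)) (hN : N.IsSymm)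
    (hgs : ∀ y, (g y).IsSymm) : Tendsto (fun y => lyap (f y) (g y)) l (𝓝 (lyap A N)) := by
  have hd : Tendsto (fun y => ‖f y - A‖) l (𝓝 0) := by
    rw [← tendsto_iff_norm_sub_tendsto_zero]; exact hf
  have hgd : Tendsto (fun y => ‖g y - N‖) l (𝓝 0) := by
    rw [← tendsto_iff_norm_sub_tendsto_zero]; exact hg
  have hsmall : ∀ᶠ y in l, 2 * ‖f y - A‖ * ‖lyap A 1‖ ≤ 1 / 2 := by
    have : Tendsto (fun y => 2 * ‖f y - A‖ * ‖lyap A 1‖) l (𝓝 (2 * 0 * ‖lyap A 1‖)) :=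
      (hd.const_mul 2).mul_const _
    simp only [mul_zero, zero_mul] at this
    exact this.eventually_le_const (by norm_num)
  rw [tendsto_iff_norm_sub_tendsto_zero]
  refine squeeze_zero' (g := fun y => ‖lyap A 1‖ *
    (‖g y - N‖ + 2 * ‖f y - A‖ * (‖lyap A 1‖ * ‖g y‖ / (1 - 1 / 2))))
    (Eventually.of_forall fun _ => norm_nonneg _) ?_ ?_
  · filter_upwards [hsmall] with y hy
    have h1 := hA.norm_lyap_add_sub_le (by norm_num) hy hN (hgs y)
    have h2 := hA.norm_lyap_add_le (by norm_num) hy (hgs y)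
    rw [add_sub_cancel] at h1 h2
    refine h1.trans ?_
    gcongr
  · have := ((hgd.add ((hd.const_mul 2).mul
      ((hg.norm.const_mul ‖lyap A 1‖).div_const (1 - 1 / 2)))).const_mul ‖lyap A 1‖)
    simpa using this

/-- Second-order remainder of the solution of a perturbed Lyapunov equation paired with a
perturbed weight. -/
lemma exists_trace_lyap_remainder_bound (b : ℝ) (hb : 0 ≤ b) (θ : ℝ) (hθ : θ < 1) :
    ∃ C : ℝ, 0 ≤ C ∧ ∀ (A E N₀ N₁ N₂ Q₀ Q₁ Q₂ : Matrix ι ι ℝ) (v : ℝ), Hurwitz A →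
      0 ≤ v → v ≤ b → N₀.IsSymm → N₁.IsSymm → N₂.IsSymm → 2 * ‖E‖ * ‖lyap A 1‖ ≤ θ →
      ‖lyap A 1‖ ≤ b → ‖E‖ ≤ b * v → ‖N₀‖ ≤ b → ‖N₁‖ ≤ b * v → ‖N₂‖ ≤ b * v ^ 2 →
      ‖Q₀‖ ≤ b → ‖Q₁‖ ≤ b * v → ‖Q₂‖ ≤ b * v ^ 2 →
      |((Q₀ + Q₁ + Q₂) * lyap (A + E) (N₀ + N₁ + N₂)).trace - (Q₀ * lyap A N₀).trace
        - ((Q₁ * lyap A N₀).trace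
          + (Q₀ * lyap A (N₁ + (E * lyap A N₀ + lyap A N₀ * Eᵀ))).trace)| ≤ C * v ^ 2 := by
  have h1θ : 0 < 1 - θ := by linarith
  -- With `X₁` the perturbed solution, `X₀` the original one and `D` the linear term, the constants
  -- will give `‖X₁‖ ≤ c₁`, `‖X₁ - X₀‖ ≤ c₂ v` and `‖X₁ - X₀ - D‖ ≤ c₃ v²`.
  obtain ⟨c₁, hc₁⟩ : ∃ c, c = b * (b + b * b + b * b ^ 2) / (1 - θ) := ⟨_, rfl⟩
  have hc₁0 : 0 ≤ c₁ := by rw [hc₁]; positivity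
  obtain ⟨c₂, hc₂⟩ : ∃ c, c = b * (b + b * b + 2 * b * c₁) := ⟨_, rfl⟩
  have hc₂0 : 0 ≤ c₂ := by rw [hc₂]; positivity
  obtain ⟨c₃, hc₃⟩ : ∃ c, c = b * (b + 2 * b * c₂) := ⟨_, rfl⟩
  have hc₃0 : 0 ≤ c₃ := by rw [hc₃]; positivity
  refine ⟨Fintype.card ι * (b * c₃ + b * c₂ + b * c₁), by positivity, ?_⟩
  intro A E N₀ N₁ N₂ Q₀ Q₁ Q₂ v hA hv hvb hN₀ hN₁ hN₂ hE hπ hEb hN₀b hN₁b hN₂b hQ₀b hQ₁b hQ₂b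
  have hAE := hA.add (hE.trans_lt hθ)
  have hNs := (hN₀.add hN₁).add hN₂
  have hX₁ := hA.norm_lyap_add_le hθ hE hNs
  have hX₁₀ := hA.norm_lyap_add_sub_le hθ hE hN₀ hNs
  -- Using the perturbation identity twice leaves `N₂` and a product of `E` with the first-order
  -- difference, both of second order.
  have hD : lyap (A + E) (N₀ + N₁ + N₂) - lyap A N₀
        - lyap A (N₁ + (E * lyap A N₀ + lyap A N₀ * Eᵀ))
      = lyap A (N₂ + (E * (lyap (A + E) (N₀ + N₁ + N₂) - lyap A N₀)
          + (lyap (A + E) (N₀ + N₁ + N₂) - lyap A N₀) * Eᵀ)) := by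
    rw [hA.lyap_add_eq hAE, ← hA.lyap_sub, ← hA.lyap_add_eq hAE]
    congr 1
    noncomm_ring
  have hDn : ‖lyap (A + E) (N₀ + N₁ + N₂) - lyap A N₀
        - lyap A (N₁ + (E * lyap A N₀ + lyap A N₀ * Eᵀ))‖
      ≤ ‖lyap A 1‖ * (‖N₂‖ + 2 * ‖E‖ * ‖lyap (A + E) (N₀ + N₁ + N₂) - lyap A N₀‖) := by
    rw [hD]
    refine (hA.norm_lyap_le (hN₂.add (isSymm_mul_add_mul_transpose E
      ((hAE.lyap_isSymm hNs).sub (hA.lyap_isSymm hN₀))))).trans ?_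
    gcongr
    exact (norm_add_le _ _).trans (add_le_add_right (norm_mul_add_mul_transpose_le _ _) _)
  set X₀ := lyap A N₀
  set X₁ := lyap (A + E) (N₀ + N₁ + N₂)
  set D := lyap A (N₁ + (E * X₀ + X₀ * Eᵀ))
  have hv2 : v ^ 2 ≤ b ^ 2 := by gcongr
  have e₁ : ‖X₁‖ ≤ c₁ := by
    refine hX₁.trans ?_
    rw [hc₁]
    have : ‖N₀ + N₁ + N₂‖ ≤ b + b * b + b * b ^ 2 := by
      refine (norm_add₃_le).trans ?_
      refine add_le_add (add_le_add hN₀b (hN₁b.trans ?_)) (hN₂b.trans ?_) <;> gcongr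
    gcongr
  have e₂ : ‖X₁ - X₀‖ ≤ c₂ * v := by
    refine hX₁₀.trans ?_
    have h1 : ‖N₀ + N₁ + N₂ - N₀‖ ≤ b * v + b * v ^ 2 := by
      have : N₀ + N₁ + N₂ - N₀ = N₁ + N₂ := by abel
      rw [this]
      exact (norm_add_le _ _).trans (add_le_add hN₁b hN₂b)
    calc _ ≤ b * ((b * v + b * (b * v)) + 2 * (b * v) * c₁) := by
          gcongr
          refine h1.trans ?_
          gcongr
          nlinarith
      _ = c₂ * v := by rw [hc₂]; ring
  have e₃ : ‖X₁ - X₀ - D‖ ≤ c₃ * v ^ 2 := by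
    refine hDn.trans ?_
    calc _ ≤ b * (b * v ^ 2 + 2 * (b * v) * (c₂ * v)) := by gcongr
      _ = c₃ * v ^ 2 := by rw [hc₃]; ring
  have hsplit : ((Q₀ + Q₁ + Q₂) * X₁).trace - (Q₀ * X₀).trace
      - ((Q₁ * X₀).trace + (Q₀ * D).trace)
      = (Q₀ * (X₁ - X₀ - D)).trace + (Q₁ * (X₁ - X₀)).trace + (Q₂ * X₁).trace := by
    simp only [add_mul, mul_sub, Matrix.trace_add, Matrix.trace_sub]
    ring
  rw [hsplit]
  refine (abs_add_three _ _ _).trans ?_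
  have t₁ := abs_trace_mul_le Q₀ (X₁ - X₀ - D)
  have t₂ := abs_trace_mul_le Q₁ (X₁ - X₀)
  have t₃ := abs_trace_mul_le Q₂ X₁
  calc _ ≤ Fintype.card ι * (b * (c₃ * v ^ 2)) + Fintype.card ι * ((b * v) * (c₂ * v))
        + Fintype.card ι * ((b * v ^ 2) * c₁) := by
        refine add_le_add (add_le_add (t₁.trans ?_) (t₂.trans ?_)) (t₃.trans ?_) <;> gcongr
    _ = _ := by ring

end NormEstimates

/-! ### Positive definiteness of the closed-loop Grammians -/

section Grammians

lemma eq_zero_of_rank_eq {κ : Type*} [Fintype κ] {n : ℕ} {M : Matrix κ (Fin n) ℝ} (h : M.rank = n)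
    {x : Fin n → ℝ} (hx : M *ᵥ x = 0) : x = 0 := by
  have h1 := LinearMap.finrank_range_add_finrank_ker M.mulVecLin
  rw [← Matrix.rank, h, Module.finrank_fin_fun, Nat.add_eq_left, Submodule.finrank_eq_zero] at h1
  have h2 : x ∈ LinearMap.ker M.mulVecLin := by simpa using hx
  rw [h1] at h2
  simpa using h2

lemma Controllable.eq_zero {n : ℕ} {κ : Type*} [Fintype κ] {A : Matrix (Fin n) (Fin n) ℝ}
    {B : Matrix (Fin n) κ ℝ} (h : Controllable A B) {x : Fin n → ℝ}
    (hx : ∀ k : ℕ, Bᵀ *ᵥ (Aᵀ ^ k *ᵥ x) = 0) : x = 0 := by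
  rw [Controllable, ← Matrix.rank_transpose] at h
  refine eq_zero_of_rank_eq h (funext fun kj => ?_)
  have := congrFun (hx kj.1) kj.2
  rw [Matrix.mulVec_mulVec, ← Matrix.transpose_pow, ← Matrix.transpose_mul] at this
  exact this

lemma Observable.eq_zero {n : ℕ} {κ : Type*} [Fintype κ] {A : Matrix (Fin n) (Fin n) ℝ}
    {C : Matrix κ (Fin n) ℝ} (h : Observable A C) {x : Fin n → ℝ}
    (hx : ∀ k : ℕ, C *ᵥ (A ^ k *ᵥ x) = 0) : x = 0 := by
  refine eq_zero_of_rank_eq h (funext fun kj => ?_)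
  have := congrFun (hx kj.1) kj.2
  rw [Matrix.mulVec_mulVec] at this
  exact this

/-- If each off-diagonal block factors through the input matrix of the corresponding subsystem,
then controllability of the subsystems makes the Grammian of the whole positive definite. -/
lemma Hurwitz.lyap_fromBlocks_posDef {n : ℕ} {κ₁ κ₂ : Type*} [Fintype κ₁] [Fintype κ₂]
    {A₁ A₂ : Matrix (Fin n) (Fin n) ℝ} {B₁ : Matrix (Fin n) κ₁ ℝ} {B₂ : Matrix (Fin n) κ₂ ℝ}
    {Z : Matrix κ₁ (Fin n) ℝ} {Y : Matrix κ₂ (Fin n) ℝ}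
    (hA : Hurwitz (Matrix.fromBlocks A₁ (B₁ * Z) (B₂ * Y) A₂))
    (h₁ : ∀ x : Fin n → ℝ, (∀ k : ℕ, B₁ᵀ *ᵥ (A₁ᵀ ^ k *ᵥ x) = 0) → x = 0)
    (h₂ : ∀ x : Fin n → ℝ, (∀ k : ℕ, B₂ᵀ *ᵥ (A₂ᵀ ^ k *ᵥ x) = 0) → x = 0) :
    (lyap (Matrix.fromBlocks A₁ (B₁ * Z) (B₂ * Y) A₂)
      (Matrix.fromBlocks B₁ 0 0 B₂ * (Matrix.fromBlocks B₁ 0 0 B₂)ᵀ)).PosDef := by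
  have hker := fun x => hA.mulVec_transpose_of_lyap_mulVec_eq_zero (x := x)
    (Matrix.fromBlocks B₁ 0 0 B₂)
  have hpsd := hA.lyap_posSemidef
    (Matrix.posSemidef_self_mul_conjTranspose (Matrix.fromBlocks B₁ 0 0 B₂))
  rw [Matrix.conjTranspose_eq_transpose_of_trivial] at hpsd
  set X := lyap (Matrix.fromBlocks A₁ (B₁ * Z) (B₂ * Y) A₂)
      (Matrix.fromBlocks B₁ 0 0 B₂ * (Matrix.fromBlocks B₁ 0 0 B₂)ᵀ)
  have hB : ∀ x₁ x₂, X *ᵥ (Sum.elim x₁ x₂) = 0 → B₁ᵀ *ᵥ x₁ = 0 ∧ B₂ᵀ *ᵥ x₂ = 0 := by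
    intro x₁ x₂ hx
    have h := (hker _ hx).1
    rw [Matrix.fromBlocks_transpose, Matrix.fromBlocks_mulVec] at h
    constructor
    · funext i
      simpa using congrFun h (Sum.inl i)
    · funext i
      simpa using congrFun h (Sum.inr i)
  -- On the kernel `B₁ᵀ x₁` and `B₂ᵀ x₂` vanish, and each transposed off-diagonal block factors
  -- through one of them. So the transposed system acts block-diagonally there.
  have hAx : ∀ x₁ x₂, X *ᵥ (Sum.elim x₁ x₂) = 0 →
      X *ᵥ (Sum.elim (A₁ᵀ *ᵥ x₁) (A₂ᵀ *ᵥ x₂)) = 0 := by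
    intro x₁ x₂ hx
    have h := (hker _ hx).2
    obtain ⟨h1, h2⟩ := hB x₁ x₂ hx
    rw [Matrix.fromBlocks_transpose, Matrix.fromBlocks_mulVec] at h
    simpa [Matrix.transpose_mul, ← Matrix.mulVec_mulVec, Sum.elim_comp_inl, Sum.elim_comp_inr,
      h1, h2] using h
  have hpow : ∀ k : ℕ, ∀ x₁ x₂, X *ᵥ (Sum.elim x₁ x₂) = 0 →
      B₁ᵀ *ᵥ (A₁ᵀ ^ k *ᵥ x₁) = 0 ∧ B₂ᵀ *ᵥ (A₂ᵀ ^ k *ᵥ x₂) = 0 := by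
    intro k
    induction k with
    | zero => intro x₁ x₂ hx; simpa using hB x₁ x₂ hx
    | succ k ih =>
      intro x₁ x₂ hx
      simpa [pow_succ, ← Matrix.mulVec_mulVec] using ih _ _ (hAx x₁ x₂ hx)
  refine .of_dotProduct_mulVec_pos hpsd.isHermitian fun x hx => ?_
  refine lt_of_le_of_ne (hpsd.dotProduct_mulVec_nonneg x) fun h0 => hx ?_
  have hx0 := (hpsd.dotProduct_mulVec_zero_iff x).1 h0.symm
  rw [← Sum.elim_comp_inl_inr x] at hx0 ⊢
  rw [h₁ _ fun k => (hpow k _ _ hx0).1, h₂ _ fun k => (hpow k _ _ hx0).2]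
  ext i
  cases i <;> rfl

lemma trace_mul_mul_transpose_nonneg {ι κ : Type*} [Fintype ι] [Fintype κ] {X : Matrix κ κ ℝ}
    (hX : X.PosSemidef) (M : Matrix ι κ ℝ) : 0 ≤ (M * X * Mᵀ).trace := by
  simpa using (hX.mul_mul_conjTranspose_same M).trace_nonneg

lemma eq_zero_of_trace_mul_mul_transpose {ι κ : Type*} [Fintype ι] [Fintype κ] {X : Matrix κ κ ℝ}
    (hX : X.PosDef) {M : Matrix ι κ ℝ} (h : (M * X * Mᵀ).trace = 0) : M = 0 := by
  classical
  have h1 := hX.posSemidef.mul_mul_conjTranspose_same M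
  rw [Matrix.conjTranspose_eq_transpose_of_trivial] at h1
  have h2 := h1.trace_eq_zero_iff.1 h
  have h3 : ∀ x : ι → ℝ, Mᵀ *ᵥ x = 0 := by
    intro x
    by_contra hne
    have h4 := hX.dotProduct_mulVec_pos hne
    rw [star_trivial, ← dotProduct_mulVec_conj, h2] at h4
    simp at h4
  rw [← Matrix.transpose_eq_zero]
  exact Matrix.ext_of_mulVec_single fun i => by rw [h3, Matrix.zero_mulVec]

end Grammians

namespace Problem

variable {n m p : ℕ} (P : Problem n m p)

/-- The plant block has identity input matrix, so its controllability is automatic; the controller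
block uses minimality. -/
lemma Wc_posDef {K : Ctrl n m p} (hK : K ∈ P.minimal) : (P.Wc K).PosDef := by
  have h := hK.1
  simp only [stabilizing, Set.mem_ofPred_eq, Acl] at h
  rw [← one_mul (P.B * K.c)] at h
  have := h.lyap_fromBlocks_posDef (fun x hx => by simpa using hx 0) (fun x => hK.2.1.eq_zero)
  rw [one_mul] at this
  exact this

lemma Wo_posDef (hP : P.Standard) {K : Ctrl n m p} (hK : K ∈ P.minimal) : (P.Wo K).PosDef := by
  have h := Hurwitz.transpose hK.1
  have e1 : (P.Acl K)ᵀ = Matrix.fromBlocks P.Aᵀ (P.Cᵀ * K.bᵀ) (K.cᵀ * P.Bᵀ) K.aᵀ := by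
    rw [Acl, Matrix.fromBlocks_transpose, Matrix.transpose_mul, Matrix.transpose_mul]
  have e2 : (P.Ccl K)ᵀ = Matrix.fromBlocks P.Cᵀ 0 0 K.cᵀ := by
    rw [Ccl, Matrix.fromBlocks_transpose, Matrix.transpose_zero, Matrix.transpose_zero]
  rw [e1] at h
  have := h.lyap_fromBlocks_posDef
    (fun x hx => hP.observable_C.eq_zero (by simpa using hx))
    (fun x hx => hK.2.2.eq_zero (by simpa using hx))
  rw [← e1, ← e2, Matrix.transpose_transpose] at this
  exact this

/-! ### Linearity -/

lemma Ehat_add (U V : Ctrl n m p) : P.Ehat (U + V) = P.Ehat U + P.Ehat V := by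
  simp [Ehat, Ctrl.a, Ctrl.b, Ctrl.c, Matrix.fromBlocks_add, Matrix.mul_add, Matrix.add_mul]

lemma Ehat_smul (t : ℝ) (V : Ctrl n m p) : P.Ehat (t • V) = t • P.Ehat V := by
  simp [Ehat, Ctrl.a, Ctrl.b, Ctrl.c, Matrix.fromBlocks_smul]

lemma Fhat_add (U V : Ctrl n m p) : Fhat (U + V) = Fhat U + Fhat V := by
  simp [Fhat, Ctrl.b, Matrix.fromBlocks_add]

lemma Fhat_smul (t : ℝ) (V : Ctrl n m p) : Fhat (t • V) = t • Fhat V := by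
  simp [Fhat, Ctrl.b, Matrix.fromBlocks_smul]

lemma Ghat_add (U V : Ctrl n m p) : Ghat (U + V) = Ghat U + Ghat V := by
  simp [Ghat, Ctrl.c, Matrix.fromBlocks_add]

lemma Ghat_smul (t : ℝ) (V : Ctrl n m p) : Ghat (t • V) = t • Ghat V := by
  simp [Ghat, Ctrl.c, Matrix.fromBlocks_smul]

lemma Acl_add (K V : Ctrl n m p) : P.Acl (K + V) = P.Acl K + P.Ehat V := by
  simp [Acl, Ehat, Ctrl.a, Ctrl.b, Ctrl.c, Matrix.fromBlocks_add, Matrix.mul_add, Matrix.add_mul]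

variable (w₁ w₂ w₃ : ℝ)

/-- The Krishnaprasad–Martin metric at `K` as a bilinear map. -/
def kmBilin (K : Ctrl n m p) : Ctrl n m p →ₗ[ℝ] Ctrl n m p →ₗ[ℝ] ℝ :=
  LinearMap.mk₂ ℝ (P.km w₁ w₂ w₃ K)
    (fun U V W => by
      simp only [km, Ehat_add, Fhat_add, Ghat_add, Matrix.mul_add, Matrix.add_mul,
        Matrix.transpose_add, Matrix.trace_add]
      ring)
    (fun t U V => by
      simp only [km, Ehat_smul, Fhat_smul, Ghat_smul, Matrix.mul_smul, Matrix.smul_mul,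
        Matrix.transpose_smul, Matrix.trace_smul, smul_eq_mul]
      ring)
    (fun U V W => by
      simp only [km, Ehat_add, Fhat_add, Ghat_add, Matrix.mul_add,
        Matrix.transpose_add, Matrix.trace_add]
      ring)
    (fun t U V => by
      simp only [km, Ehat_smul, Fhat_smul, Ghat_smul, Matrix.mul_smul,
        Matrix.transpose_smul, Matrix.trace_smul, smul_eq_mul]
      ring)

lemma kmBilin_apply (K U V : Ctrl n m p) : P.kmBilin w₁ w₂ w₃ K U V = P.km w₁ w₂ w₃ K U V := rfl

variable {w₁ w₂ w₃}

/-! ### Positivity of the metric -/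

lemma km_pos (hP : P.Standard) (hw₁ : 0 < w₁) (hw₂ : 0 ≤ w₂) (hw₃ : 0 ≤ w₃)
    (hC : 0 < w₂ ∨ P.C.rank = p) (hB : 0 < w₃ ∨ P.B.rank = m) {K V : Ctrl n m p}
    (hK : K ∈ P.minimal) (hV : V ≠ 0) : 0 < P.km w₁ w₂ w₃ K V V := by
  have hWc := P.Wc_posDef hK
  have hWo := P.Wo_posDef hP hK
  -- Factoring `W_o = Sᵀ S` with `S` invertible puts the first term in the form `tr (M W_c Mᵀ)` with
  -- `M = S Ê(V)`, so its vanishing forces `Ê(V) = 0`.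
  obtain ⟨S, hSu, hS⟩ : ∃ S : Matrix (Fin n ⊕ Fin n) (Fin n ⊕ Fin n) ℝ,
      IsUnit S ∧ P.Wo K = Sᵀ * S := by
    obtain ⟨S, hS⟩ := CStarAlgebra.nonneg_iff_eq_star_mul_self.1
      (Matrix.nonneg_iff_posSemidef.2 hWo.posSemidef)
    refine ⟨S, ?_, hS⟩
    have h := hWo.isUnit
    rw [hS, Matrix.isUnit_iff_isUnit_det, Matrix.det_mul] at h
    exact (Matrix.isUnit_iff_isUnit_det _).2 (isUnit_of_mul_isUnit_right h)
  have t₁ : (P.Wo K * P.Ehat V * P.Wc K * (P.Ehat V)ᵀ).trace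
      = ((S * P.Ehat V) * P.Wc K * (S * P.Ehat V)ᵀ).trace := by
    rw [hS, Matrix.transpose_mul, ← mul_assoc, Matrix.trace_mul_comm _ Sᵀ]
    simp only [mul_assoc]
  have n₁ := trace_mul_mul_transpose_nonneg hWc.posSemidef (S * P.Ehat V)
  have n₂ : 0 ≤ ((Fhat V)ᵀ * P.Wo K * Fhat V).trace := by
    simpa using trace_mul_mul_transpose_nonneg hWo.posSemidef (Fhat V)ᵀ
  have n₃ := trace_mul_mul_transpose_nonneg hWc.posSemidef (Ghat V)
  rw [km, t₁]
  have m₁ := mul_nonneg hw₁.le n₁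
  have m₂ := mul_nonneg hw₂ n₂
  have m₃ := mul_nonneg hw₃ n₃
  refine lt_of_le_of_ne (by positivity) fun h0 => hV ?_
  have z₁ : ((S * P.Ehat V) * P.Wc K * (S * P.Ehat V)ᵀ).trace = 0 := by
    have : w₁ * ((S * P.Ehat V) * P.Wc K * (S * P.Ehat V)ᵀ).trace = 0 := by linarith
    exact (mul_eq_zero.1 this).resolve_left hw₁.ne'
  have z₂ : w₂ * ((Fhat V)ᵀ * P.Wo K * Fhat V).trace = 0 := by linarith
  have z₃ : w₃ * (Ghat V * P.Wc K * (Ghat V)ᵀ).trace = 0 := by linarith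
  have hE : P.Ehat V = 0 := by
    have h := eq_zero_of_trace_mul_mul_transpose hWc z₁
    rwa [hSu.mul_right_eq_zero] at h
  rw [Ehat, ← Matrix.fromBlocks_zero, Matrix.fromBlocks_inj] at hE
  obtain ⟨-, hBc, hbC, ha⟩ := hE
  have hb : V.b = 0 := by
    rcases hC with hw | hr
    · have h := eq_zero_of_trace_mul_mul_transpose (M := (Fhat V)ᵀ) hWo (by
        simpa using (mul_eq_zero.1 z₂).resolve_left hw.ne')
      rw [Matrix.transpose_eq_zero, Fhat, ← Matrix.fromBlocks_zero, Matrix.fromBlocks_inj] at h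
      exact h.2.2.2
    · funext i
      refine eq_zero_of_rank_eq (M := P.Cᵀ) (by rw [Matrix.rank_transpose, hr]) ?_
      rw [Matrix.mulVec_transpose]
      exact congrFun hbC i
  have hc : V.c = 0 := by
    rcases hB with hw | hr
    · have h := eq_zero_of_trace_mul_mul_transpose hWc ((mul_eq_zero.1 z₃).resolve_left hw.ne')
      rw [Ghat, ← Matrix.fromBlocks_zero, Matrix.fromBlocks_inj] at h
      exact h.2.2.2
    · rw [← Matrix.transpose_eq_zero]
      funext i
      refine eq_zero_of_rank_eq (M := P.B) hr ?_
      funext j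
      exact congrFun (congrFun hBc j) i
  exact Prod.ext ha (Prod.ext hb hc)

end Problem

namespace Problem

variable {n m p : ℕ} (P : Problem n m p)

/-! ### The differential of the cost -/

/-- The differential of `Qcl`. -/
def dQcl (K V : Ctrl n m p) : Matrix (Fin n ⊕ Fin n) (Fin n ⊕ Fin n) ℝ :=
  Matrix.fromBlocks 0 0 0 (K.cᵀ * P.R * V.c + V.cᵀ * P.R * K.c)

/-- The differential of `Wcl`. -/
def dWcl (K V : Ctrl n m p) : Matrix (Fin n ⊕ Fin n) (Fin n ⊕ Fin n) ℝ :=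
  Matrix.fromBlocks 0 0 0 (K.b * P.V * V.bᵀ + V.b * P.V * K.bᵀ)

/-- The state covariance of the closed loop. -/
def covariance (K : Ctrl n m p) : Matrix (Fin n ⊕ Fin n) (Fin n ⊕ Fin n) ℝ :=
  lyap (P.Acl K) (P.Wcl K)

/-- The differential of the right-hand side of the Lyapunov equation for the covariance. -/
def covarianceSource (K V : Ctrl n m p) : Matrix (Fin n ⊕ Fin n) (Fin n ⊕ Fin n) ℝ :=
  P.dWcl K V + (P.Ehat V * P.covariance K + P.covariance K * (P.Ehat V)ᵀ)

/-- The differential of the cost in closed form. -/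
def costDeriv (K V : Ctrl n m p) : ℝ :=
  (P.dQcl K V * P.covariance K).trace
    + (P.Qcl K * lyap (P.Acl K) (P.covarianceSource K V)).trace

lemma Qcl_add (K V : Ctrl n m p) : P.Qcl (K + V) = P.Qcl K + P.dQcl K V
    + Matrix.fromBlocks 0 0 0 (V.cᵀ * P.R * V.c) := by
  simp only [Qcl, dQcl, Matrix.fromBlocks_add, add_zero]
  congr 1
  change (K.c + V.c)ᵀ * P.R * (K.c + V.c) = _
  rw [Matrix.transpose_add]
  simp only [Matrix.add_mul, Matrix.mul_add]
  abel

lemma Wcl_add (K V : Ctrl n m p) : P.Wcl (K + V) = P.Wcl K + P.dWcl K V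
    + Matrix.fromBlocks 0 0 0 (V.b * P.V * V.bᵀ) := by
  simp only [Wcl, dWcl, Matrix.fromBlocks_add, add_zero]
  congr 1
  change (K.b + V.b) * P.V * (K.b + V.b)ᵀ = _
  rw [Matrix.transpose_add]
  simp only [Matrix.add_mul, Matrix.mul_add]
  abel

variable {P}

lemma Standard.transpose_W (hP : P.Standard) : P.Wᵀ = P.W := by
  simpa using hP.posSemidef_W.isHermitian.eq

lemma Standard.transpose_V (hP : P.Standard) : P.Vᵀ = P.V := by
  simpa using hP.posDef_V.isHermitian.eq

lemma Wcl_isSymm (hP : P.Standard) (K : Ctrl n m p) : (P.Wcl K).IsSymm := by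
  simp [Matrix.IsSymm, Wcl, Matrix.fromBlocks_transpose, Matrix.transpose_mul, hP.transpose_W,
    hP.transpose_V, Matrix.mul_assoc]

lemma fromBlocks_VbT_isSymm (hP : P.Standard) (V : Ctrl n m p) :
    (Matrix.fromBlocks 0 0 0 (V.b * P.V * V.bᵀ) :
      Matrix (Fin n ⊕ Fin n) (Fin n ⊕ Fin n) ℝ).IsSymm := by
  simp [Matrix.IsSymm, Matrix.fromBlocks_transpose, Matrix.transpose_mul, hP.transpose_V, Matrix.mul_assoc]

lemma dWcl_isSymm (hP : P.Standard) (K V : Ctrl n m p) : (P.dWcl K V).IsSymm := by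
  simp [Matrix.IsSymm, dWcl, Matrix.fromBlocks_transpose, Matrix.transpose_mul, hP.transpose_V,
    Matrix.mul_assoc, add_comm]

lemma covariance_isSymm (hP : P.Standard) {K : Ctrl n m p} (hK : K ∈ P.stabilizing) :
    (P.covariance K).IsSymm := Hurwitz.lyap_isSymm hK (Wcl_isSymm hP K)

lemma covarianceSource_isSymm (hP : P.Standard) {K : Ctrl n m p} (hK : K ∈ P.stabilizing)
    (V : Ctrl n m p) : (P.covarianceSource K V).IsSymm :=
  (dWcl_isSymm hP K V).add (isSymm_mul_add_mul_transpose _ (covariance_isSymm hP hK))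

variable (P)

lemma costDeriv_add {K : Ctrl n m p} (hK : K ∈ P.stabilizing) (U V : Ctrl n m p) :
    P.costDeriv K (U + V) = P.costDeriv K U + P.costDeriv K V := by
  have h1 : P.dQcl K (U + V) = P.dQcl K U + P.dQcl K V := by
    simp only [dQcl, Matrix.fromBlocks_add, add_zero]
    congr 1
    change K.cᵀ * P.R * (U.c + V.c) + (U.c + V.c)ᵀ * P.R * K.c = _
    rw [Matrix.transpose_add]
    simp only [Matrix.add_mul, Matrix.mul_add]
    abel
  have h2 : P.covarianceSource K (U + V) = P.covarianceSource K U + P.covarianceSource K V := by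
    have : P.dWcl K (U + V) = P.dWcl K U + P.dWcl K V := by
      simp only [dWcl, Matrix.fromBlocks_add, add_zero]
      congr 1
      change K.b * P.V * (U.b + V.b)ᵀ + (U.b + V.b) * P.V * K.bᵀ = _
      rw [Matrix.transpose_add]
      simp only [Matrix.add_mul, Matrix.mul_add]
      abel
    rw [covarianceSource, this, Ehat_add, Matrix.transpose_add, covarianceSource, covarianceSource]
    noncomm_ring
  rw [costDeriv, h1, h2, Hurwitz.lyap_add hK, Matrix.add_mul, Matrix.mul_add, Matrix.trace_add,
    Matrix.trace_add, costDeriv, costDeriv]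
  ring

lemma costDeriv_smul {K : Ctrl n m p} (hK : K ∈ P.stabilizing) (t : ℝ) (V : Ctrl n m p) :
    P.costDeriv K (t • V) = t * P.costDeriv K V := by
  have h1 : P.dQcl K (t • V) = t • P.dQcl K V := by
    simp only [dQcl, Matrix.fromBlocks_smul, smul_zero]
    congr 1
    change K.cᵀ * P.R * (t • V.c) + (t • V.c)ᵀ * P.R * K.c = _
    simp [smul_add]
  have h2 : P.covarianceSource K (t • V) = t • P.covarianceSource K V := by
    have : P.dWcl K (t • V) = t • P.dWcl K V := by
      simp only [dWcl, Matrix.fromBlocks_smul, smul_zero]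
      congr 1
      change K.b * P.V * (t • V.b)ᵀ + (t • V.b) * P.V * K.bᵀ = _
      simp [smul_add]
    rw [covarianceSource, this, Ehat_smul, Matrix.transpose_smul, covarianceSource]
    simp [smul_add]
  rw [costDeriv, h1, h2, Hurwitz.lyap_smul hK, Matrix.smul_mul, Matrix.mul_smul,
    Matrix.trace_smul, Matrix.trace_smul, costDeriv, smul_eq_mul, smul_eq_mul]
  ring

/-! ### The second-order remainder of the cost -/

section Remainder

open scoped Matrix.Norms.L2Operator

lemma exists_norm_Ehat_le : ∃ c : ℝ, 0 ≤ c ∧ ∀ V : Ctrl n m p, ‖P.Ehat V‖ ≤ c * ‖V‖ := by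
  let f : Ctrl n m p →ₗ[ℝ] Matrix (Fin n ⊕ Fin n) (Fin n ⊕ Fin n) ℝ :=
    { toFun := P.Ehat, map_add' := P.Ehat_add, map_smul' := P.Ehat_smul }
  obtain ⟨c, hc, h⟩ := (LinearMap.toContinuousLinearMap f).bound
  exact ⟨c, hc.le, h⟩

lemma exists_norm_fromBlocks_le (n : ℕ) : ∃ c : ℝ, 0 ≤ c ∧ ∀ M : Matrix (Fin n) (Fin n) ℝ,
    ‖(Matrix.fromBlocks 0 0 0 M : Matrix (Fin n ⊕ Fin n) (Fin n ⊕ Fin n) ℝ)‖ ≤ c * ‖M‖ := by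
  let f : Matrix (Fin n) (Fin n) ℝ →ₗ[ℝ] Matrix (Fin n ⊕ Fin n) (Fin n ⊕ Fin n) ℝ :=
    { toFun := fun M => Matrix.fromBlocks 0 0 0 M
      map_add' := fun M N => by simp [Matrix.fromBlocks_add]
      map_smul' := fun t M => by simp [Matrix.fromBlocks_smul] }
  obtain ⟨c, hc, h⟩ := (LinearMap.toContinuousLinearMap f).bound
  exact ⟨c, hc.le, h⟩

lemma norm_mul_mul_le {ι κ μ ν : Type*} [Fintype ι] [Fintype κ] [Fintype μ] [Fintype ν]
    [DecidableEq ι] [DecidableEq κ] [DecidableEq μ] [DecidableEq ν]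
    (M : Matrix ι κ ℝ) (N : Matrix κ μ ℝ) (L : Matrix μ ν ℝ) :
    ‖M * N * L‖ ≤ ‖M‖ * ‖N‖ * ‖L‖ :=
  (Matrix.l2_opNorm_mul _ _).trans (by gcongr; exact Matrix.l2_opNorm_mul _ _)

lemma norm_b_le (K : Ctrl n m p) : ‖K.b‖ ≤ ‖K‖ := (norm_fst_le K.2).trans (norm_snd_le K)

lemma norm_c_le (K : Ctrl n m p) : ‖K.c‖ ≤ ‖K‖ := (norm_snd_le K.2).trans (norm_snd_le K)

/-- Used twice: along a line it identifies the derivative of the cost, and on a compact set it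
supplies the uniform quadratic bound. -/
lemma exists_cost_remainder_bound (hP : P.Standard) {M : ℝ} (hM : 0 ≤ M) {θ : ℝ} (hθ : θ < 1) :
    ∃ C : ℝ, 0 ≤ C ∧ ∀ K ∈ P.stabilizing, ∀ V : Ctrl n m p, ‖K‖ ≤ M → ‖V‖ ≤ M →
      ‖lyap (P.Acl K) 1‖ ≤ M → 2 * ‖P.Ehat V‖ * ‖lyap (P.Acl K) 1‖ ≤ θ →
      K + V ∈ P.stabilizing ∧
        |P.cost (K + V) - P.cost K - P.costDeriv K V| ≤ C * ‖V‖ ^ 2 := by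
  obtain ⟨e, he0, he⟩ := P.exists_norm_Ehat_le
  obtain ⟨c, hc0, hc⟩ := exists_norm_fromBlocks_le n
  obtain ⟨r, hr⟩ : ∃ r, r = ‖P.R‖ + ‖P.V‖ := ⟨_, rfl⟩
  have hr0 : 0 ≤ r := by rw [hr]; positivity
  have hRr : ‖P.R‖ ≤ r := by rw [hr]; linarith [norm_nonneg P.V]
  have hVr : ‖P.V‖ ≤ r := by rw [hr]; linarith [norm_nonneg P.R]
  obtain ⟨q, hq⟩ : ∃ q : ℝ, q =
      ‖(Matrix.fromBlocks P.Q 0 0 0 : Matrix (Fin n ⊕ Fin n) (Fin n ⊕ Fin n) ℝ)‖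
      + ‖(Matrix.fromBlocks P.W 0 0 0 : Matrix (Fin n ⊕ Fin n) (Fin n ⊕ Fin n) ℝ)‖ := ⟨_, rfl⟩
  have hq0 : 0 ≤ q := by rw [hq]; positivity
  -- The summands bound, in order, `K`, `V` and the Lyapunov solution; `Ê`; the constant, linear and
  -- quadratic parts of the cost and noise blocks.
  obtain ⟨b, hb⟩ : ∃ b, b = M + e + (q + c * (M * r * M)) + c * (2 * (M * r)) + c * r := ⟨_, rfl⟩
  have hb1 : M ≤ b := by
    rw [hb]
    linarith [show 0 ≤ e + (q + c * (M * r * M)) + c * (2 * (M * r)) + c * r by positivity]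
  have hb2 : e ≤ b := by
    rw [hb]
    linarith [show 0 ≤ M + (q + c * (M * r * M)) + c * (2 * (M * r)) + c * r by positivity]
  have hb3 : q + c * (M * r * M) ≤ b := by
    rw [hb]
    linarith [show 0 ≤ M + e + c * (2 * (M * r)) + c * r by positivity]
  have hb4 : c * (2 * (M * r)) ≤ b := by
    rw [hb]
    linarith [show 0 ≤ M + e + (q + c * (M * r * M)) + c * r by positivity]
  have hb5 : c * r ≤ b := by
    rw [hb]
    linarith [show 0 ≤ M + e + (q + c * (M * r * M)) + c * (2 * (M * r)) by positivity]
  obtain ⟨C, hC0, hC⟩ := exists_trace_lyap_remainder_bound (ι := Fin n ⊕ Fin n) b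
    (hM.trans hb1) θ hθ
  refine ⟨C, hC0, fun K hK V hKM hVM hL hE => ?_⟩
  have hst : K + V ∈ P.stabilizing := by
    have := Hurwitz.add hK (hE.trans_lt hθ)
    rw [← Acl_add] at this
    exact this
  refine ⟨hst, ?_⟩
  have hKb := (norm_b_le K).trans hKM
  have hKc := (norm_c_le K).trans hKM
  have hVb := norm_b_le V
  have hVc := norm_c_le V
  have hKbT : ‖K.bᵀ‖ ≤ M := by rwa [norm_transpose_eq]
  have hKcT : ‖K.cᵀ‖ ≤ M := by rwa [norm_transpose_eq]
  have hVbT : ‖V.bᵀ‖ ≤ ‖V‖ := by rwa [norm_transpose_eq]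
  have hVcT : ‖V.cᵀ‖ ≤ ‖V‖ := by rwa [norm_transpose_eq]
  have key := hC (P.Acl K) (P.Ehat V) (P.Wcl K) (P.dWcl K V)
    (Matrix.fromBlocks 0 0 0 (V.b * P.V * V.bᵀ)) (P.Qcl K) (P.dQcl K V)
    (Matrix.fromBlocks 0 0 0 (V.cᵀ * P.R * V.c)) ‖V‖ hK (norm_nonneg _) (hVM.trans hb1)
    (Wcl_isSymm hP K) (dWcl_isSymm hP K V) (fromBlocks_VbT_isSymm hP V) hE (hL.trans hb1)
    ((he V).trans (by gcongr)) ?_ ?_ ?_ ?_ ?_ ?_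
  · rw [← Acl_add, ← Wcl_add, ← Qcl_add] at key
    exact key
  · have h1 : P.Wcl K = Matrix.fromBlocks P.W 0 0 0
        + Matrix.fromBlocks 0 0 0 (K.b * P.V * K.bᵀ) := by
      simp [Wcl, Matrix.fromBlocks_add]
    rw [h1]
    refine ((norm_add_le _ _).trans (add_le_add ?_ ((hc _).trans ?_))).trans hb3
    · rw [hq]; exact le_add_of_nonneg_left (norm_nonneg _)
    · gcongr
      exact (norm_mul_mul_le _ _ _).trans (by gcongr)
  · refine (hc _).trans ?_
    calc _ ≤ c * (M * r * ‖V‖ + ‖V‖ * r * M) := by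
          gcongr
          refine (norm_add_le _ _).trans (add_le_add ?_ ?_) <;>
            exact (norm_mul_mul_le _ _ _).trans (by gcongr)
      _ = c * (2 * (M * r)) * ‖V‖ := by ring
      _ ≤ b * ‖V‖ := by gcongr
  · refine (hc _).trans ?_
    calc _ ≤ c * (‖V‖ * r * ‖V‖) := by
          gcongr
          exact (norm_mul_mul_le _ _ _).trans (by gcongr)
      _ = c * r * ‖V‖ ^ 2 := by ring
      _ ≤ b * ‖V‖ ^ 2 := by gcongr
  · have h1 : P.Qcl K = Matrix.fromBlocks P.Q 0 0 0
        + Matrix.fromBlocks 0 0 0 (K.cᵀ * P.R * K.c) := by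
      simp [Qcl, Matrix.fromBlocks_add]
    rw [h1]
    refine ((norm_add_le _ _).trans (add_le_add ?_ ((hc _).trans ?_))).trans hb3
    · rw [hq]; exact le_add_of_nonneg_right (norm_nonneg _)
    · gcongr
      exact (norm_mul_mul_le _ _ _).trans (by gcongr)
  · refine (hc _).trans ?_
    calc _ ≤ c * (M * r * ‖V‖ + ‖V‖ * r * M) := by
          gcongr
          refine (norm_add_le _ _).trans (add_le_add ?_ ?_) <;>
            exact (norm_mul_mul_le _ _ _).trans (by gcongr)
      _ = c * (2 * (M * r)) * ‖V‖ := by ring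
      _ ≤ b * ‖V‖ := by gcongr
  · refine (hc _).trans ?_
    calc _ ≤ c * (‖V‖ * r * ‖V‖) := by
          gcongr
          exact (norm_mul_mul_le _ _ _).trans (by gcongr)
      _ = c * r * ‖V‖ ^ 2 := by ring
      _ ≤ b * ‖V‖ ^ 2 := by gcongr

lemma eventually_stabilizing {K : Ctrl n m p} (hK : K ∈ P.stabilizing) (V : Ctrl n m p) :
    ∀ᶠ t : ℝ in 𝓝 0, 2 * ‖P.Ehat (t • V)‖ * ‖lyap (P.Acl K) 1‖ ≤ 1 / 2 ∧
      K + t • V ∈ P.stabilizing := by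
  have h : Tendsto (fun t : ℝ => 2 * ‖P.Ehat (t • V)‖ * ‖lyap (P.Acl K) 1‖) (𝓝 0)
      (𝓝 (2 * ‖(0 : ℝ) • P.Ehat V‖ * ‖lyap (P.Acl K) 1‖)) := by
    have hc : Continuous fun t : ℝ => 2 * ‖t • P.Ehat V‖ * ‖lyap (P.Acl K) 1‖ := by fun_prop
    simpa only [Ehat_smul] using hc.tendsto 0
  rw [zero_smul, norm_zero, mul_zero, zero_mul] at h
  filter_upwards [h.eventually_le_const (by norm_num : (0 : ℝ) < 1 / 2)] with t ht
  refine ⟨ht, ?_⟩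
  have := Hurwitz.add hK (ht.trans_lt (by norm_num))
  rw [← Acl_add] at this
  exact this

lemma dcost_eq (hP : P.Standard) {K : Ctrl n m p} (hK : K ∈ P.stabilizing) (V : Ctrl n m p) :
    P.dcost K V = P.costDeriv K V := by
  refine HasDerivAt.deriv ?_
  obtain ⟨C, -, hC⟩ := P.exists_cost_remainder_bound hP
    (M := ‖K‖ + ‖V‖ + ‖lyap (P.Acl K) 1‖) (by positivity) (θ := 1 / 2) (by norm_num)
  rw [hasDerivAt_iff_isLittleO]
  have hO : (fun t : ℝ => P.cost (K + t • V) - P.cost (K + (0 : ℝ) • V)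
      - (t - 0) • P.costDeriv K V) =O[𝓝 0] fun t : ℝ => t ^ 2 := by
    refine Asymptotics.IsBigO.of_bound (C * ‖V‖ ^ 2) ?_
    have h1 : ∀ᶠ t : ℝ in 𝓝 0, |t| ≤ 1 := by
      have : Tendsto (fun t : ℝ => |t|) (𝓝 0) (𝓝 |0|) := continuous_abs.tendsto 0
      rw [abs_zero] at this
      exact this.eventually_le_const one_pos
    filter_upwards [h1, P.eventually_stabilizing hK V] with t ht1 ht
    have hV : ‖t • V‖ ≤ ‖V‖ := by
      rw [norm_smul, Real.norm_eq_abs]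
      exact mul_le_of_le_one_left (norm_nonneg _) ht1
    have h2 := (hC K hK (t • V) (by linarith [norm_nonneg V, norm_nonneg (lyap (P.Acl K) 1)])
      (by linarith [norm_nonneg K, norm_nonneg (lyap (P.Acl K) 1)])
      (by linarith [norm_nonneg V, norm_nonneg K]) ht.1).2
    rw [P.costDeriv_smul hK] at h2
    rw [zero_smul, add_zero, sub_zero, smul_eq_mul, Real.norm_eq_abs]
    refine h2.trans (le_of_eq ?_)
    rw [norm_smul, norm_pow, mul_pow]
    ring
  refine hO.trans_isLittleO ?_
  simpa using Asymptotics.isLittleO_pow_id (𝕜 := ℝ) one_lt_two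

end Remainder

/-! ### The gradient -/

section Gradient

variable {w₁ w₂ w₃ : ℝ}

/-- The metric at `K` is positive definite. -/
def MetricPos (w₁ w₂ w₃ : ℝ) (K : Ctrl n m p) : Prop :=
  ∀ V : Ctrl n m p, V ≠ 0 → 0 < P.km w₁ w₂ w₃ K V V

variable {P}

/-- A kernel vector of the Gram matrix would be the coordinates of a nonzero tangent vector of
length zero. -/
lemma MetricPos.det_gram_ne_zero {K : Ctrl n m p} (h : P.MetricPos w₁ w₂ w₃ K) :
    (P.gram w₁ w₂ w₃ K).det ≠ 0 := by
  intro h0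
  obtain ⟨x, hx, hGx⟩ := Matrix.exists_mulVec_eq_zero_iff.2 h0
  set e := Module.finBasis ℝ (Ctrl n m p)
  have h1 : ∑ j, x j • e j ≠ 0 := fun hs =>
    hx (funext fun i => linearIndependent_iff'.1 e.linearIndependent Finset.univ x hs i
      (Finset.mem_univ i))
  have h2 : ∀ i, P.kmBilin w₁ w₂ w₃ K (e i) (∑ j, x j • e j) = 0 := by
    intro i
    have := congrFun hGx i
    simp only [map_sum, map_smul, smul_eq_mul]
    simpa [Matrix.mulVec, dotProduct, gram, mul_comm, kmBilin_apply] using this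
  have h3 := h _ h1
  rw [← kmBilin_apply] at h3
  have h4 : ∀ W, (∀ i, P.kmBilin w₁ w₂ w₃ K (e i) W = 0) →
      P.kmBilin w₁ w₂ w₃ K (∑ j, x j • e j) W = 0 := by
    intro W hW
    rw [map_sum, LinearMap.sum_apply]
    exact Finset.sum_eq_zero fun i _ => by rw [map_smul, LinearMap.smul_apply, hW, smul_zero]
  exact h3.ne' (h4 _ h2)

lemma MetricPos.km_grad (hP : P.Standard) {K : Ctrl n m p} (h : P.MetricPos w₁ w₂ w₃ K)
    (hK : K ∈ P.stabilizing) (V : Ctrl n m p) :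
    P.km w₁ w₂ w₃ K (P.grad w₁ w₂ w₃ K) V = P.dcost K V := by
  rw [dcost_eq P hP hK, ← kmBilin_apply]
  let d : Ctrl n m p →ₗ[ℝ] ℝ :=
    { toFun := P.costDeriv K, map_add' := P.costDeriv_add hK, map_smul' := P.costDeriv_smul hK }
  change _ = d V
  suffices hs : P.kmBilin w₁ w₂ w₃ K (P.grad w₁ w₂ w₃ K) = d by rw [hs]
  refine (Module.finBasis ℝ (Ctrl n m p)).ext fun k => ?_
  set e := Module.finBasis ℝ (Ctrl n m p) with he
  have hG : (P.gram w₁ w₂ w₃ K)⁻¹ * P.gram w₁ w₂ w₃ K = 1 :=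
    Matrix.nonsing_inv_mul _ (isUnit_iff_ne_zero.2 h.det_gram_ne_zero)
  have hGi : ∀ i, ∑ j, (P.gram w₁ w₂ w₃ K)⁻¹ i j * P.kmBilin w₁ w₂ w₃ K (e j) (e k)
      = (1 : Matrix _ _ ℝ) i k := by
    intro i
    rw [← hG]
    rfl
  have hd : ∀ i, P.dcost K (e i) = d (e i) := fun i => dcost_eq P hP hK _
  rw [grad]
  simp only [map_sum, LinearMap.sum_apply, map_smul, LinearMap.smul_apply, smul_eq_mul, ← he, hd]
  calc _ = ∑ i, d (e i) * ∑ j, (P.gram w₁ w₂ w₃ K)⁻¹ i j * P.kmBilin w₁ w₂ w₃ K (e j) (e k) := by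
        refine Finset.sum_congr rfl fun i _ => ?_
        rw [Finset.mul_sum]
        exact Finset.sum_congr rfl fun j _ => by ring
    _ = d (e k) := by
        simp only [hGi, Matrix.one_apply]
        simp

end Gradient

end Problem

/-! ### Invariance under coordinate transformations -/

section Conjugation

variable {ι : Type*} [Fintype ι] [DecidableEq ι] {A D D' : Matrix ι ι ℝ}

lemma lyapunov_conj {X N : Matrix ι ι ℝ} (h : D' * D = 1) (hX : A * X + X * Aᵀ = -N) :
    (D * A * D') * (D * X * Dᵀ) + (D * X * Dᵀ) * (D * A * D')ᵀ = -(D * N * Dᵀ) := by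
  have h' : Dᵀ * D'ᵀ = 1 := by rw [← Matrix.transpose_mul, h, Matrix.transpose_one]
  calc (D * A * D') * (D * X * Dᵀ) + (D * X * Dᵀ) * (D * A * D')ᵀ
      = D * A * (D' * D) * X * Dᵀ + D * X * (Dᵀ * D'ᵀ) * Aᵀ * Dᵀ := by
        rw [Matrix.transpose_mul, Matrix.transpose_mul]
        noncomm_ring
    _ = D * (A * X + X * Aᵀ) * Dᵀ := by rw [h, h']; noncomm_ring
    _ = -(D * N * Dᵀ) := by rw [hX]; noncomm_ring

/-- The certificate `lyap A 1` is transported to `D (lyap A 1) Dᵀ`, whose Lyapunov expression is `-D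
Dᵀ`. -/
lemma Hurwitz.conj (hA : Hurwitz A) (h : D' * D = 1) : Hurwitz (D * A * D') := by
  have hpsd := (hA.lyap_posSemidef Matrix.PosSemidef.one).mul_mul_conjTranspose_same D
  rw [Matrix.conjTranspose_eq_transpose_of_trivial] at hpsd
  refine hurwitz_of_lyapunov hpsd fun x hx => ?_
  rw [lyapunov_conj h (hA.lyap_spec 1), Matrix.neg_mulVec, dotProduct_neg, dotProduct_mulVec_conj,
    Matrix.one_mulVec, neg_lt_zero]
  have hne : Dᵀ *ᵥ x ≠ 0 := by
    intro h0
    have h1 : D'ᵀ *ᵥ (Dᵀ *ᵥ x) = x := by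
      rw [Matrix.mulVec_mulVec, ← Matrix.transpose_mul, mul_eq_one_comm.1 h, Matrix.transpose_one,
        Matrix.one_mulVec]
    rw [h0, Matrix.mulVec_zero] at h1
    exact hx h1.symm
  have h0 : 0 ≤ (Dᵀ *ᵥ x) ⬝ᵥ (Dᵀ *ᵥ x) := by
    rw [dotProduct_self_eq_norm_sq]
    positivity
  exact lt_of_le_of_ne h0 fun h1 => hne (dotProduct_self_eq_zero.1 h1.symm)

lemma Hurwitz.lyap_conj (hA : Hurwitz A) (h : D' * D = 1) (N : Matrix ι ι ℝ) :
    lyap (D * A * D') (D * N * Dᵀ) = D * lyap A N * Dᵀ :=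
  (hA.conj h).lyap_eq (lyapunov_conj h (hA.lyap_spec N))

end Conjugation

namespace Ctrl

variable {n m p : ℕ} (S : GL (Fin n) ℝ)

/-- The action of a coordinate transformation of the controller on the closed-loop state. -/
def block (S : GL (Fin n) ℝ) : Matrix (Fin n ⊕ Fin n) (Fin n ⊕ Fin n) ℝ :=
  Matrix.fromBlocks 1 0 0 (S : Matrix (Fin n) (Fin n) ℝ)

lemma block_inv_mul : block S⁻¹ * block S = 1 := by
  have h : ((S⁻¹ : GL (Fin n) ℝ) : Matrix (Fin n) (Fin n) ℝ) * S = 1 := by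
    rw [← Units.val_mul, inv_mul_cancel, Units.val_one]
  simp only [block, Matrix.fromBlocks_multiply, h, Matrix.mul_zero, Matrix.zero_mul, add_zero,
    zero_add, Matrix.mul_one, Matrix.fromBlocks_one]

lemma transform_add (K V : Ctrl n m p) :
    (K + V).transform S = K.transform S + V.transform S := by
  refine Prod.ext ?_ (Prod.ext ?_ ?_)
  · change _ * (K.a + V.a) * _ = _ * K.a * _ + _ * V.a * _
    rw [Matrix.mul_add, Matrix.add_mul]
  · change _ * (K.b + V.b) = _ * K.b + _ * V.b
    rw [Matrix.mul_add]
  · change (K.c + V.c) * _ = K.c * _ + V.c * _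
    rw [Matrix.add_mul]

lemma transform_smul (t : ℝ) (V : Ctrl n m p) : (t • V).transform S = t • V.transform S := by
  refine Prod.ext ?_ (Prod.ext ?_ ?_)
  · change _ * (t • V.a) * _ = t • (_ * V.a * _)
    rw [Matrix.mul_smul, Matrix.smul_mul]
  · change _ * (t • V.b) = t • (_ * V.b)
    rw [Matrix.mul_smul]
  · change (t • V.c) * _ = t • (V.c * _)
    rw [Matrix.smul_mul]

lemma transform_inv_transform (V : Ctrl n m p) : (V.transform S⁻¹).transform S = V := by
  have h : (S : Matrix (Fin n) (Fin n) ℝ) * ((S⁻¹ : GL (Fin n) ℝ) : Matrix (Fin n) (Fin n) ℝ)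
      = 1 := by
    rw [← Units.val_mul, mul_inv_cancel, Units.val_one]
  refine Prod.ext ?_ (Prod.ext ?_ ?_)
  · change (S : Matrix (Fin n) (Fin n) ℝ) * (((S⁻¹ : GL (Fin n) ℝ) : Matrix (Fin n) (Fin n) ℝ)
      * V.a * ((S⁻¹⁻¹ : GL (Fin n) ℝ) : Matrix (Fin n) (Fin n) ℝ)) * _ = V.a
    rw [inv_inv, ← Matrix.mul_assoc, ← Matrix.mul_assoc, h, Matrix.one_mul, Matrix.mul_assoc, h,
      Matrix.mul_one]
  · change (S : Matrix (Fin n) (Fin n) ℝ) * (((S⁻¹ : GL (Fin n) ℝ) : Matrix (Fin n) (Fin n) ℝ)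
      * V.b) = V.b
    rw [← Matrix.mul_assoc, h, Matrix.one_mul]
  · change V.c * ((S⁻¹⁻¹ : GL (Fin n) ℝ) : Matrix (Fin n) (Fin n) ℝ) * _ = V.c
    rw [inv_inv, Matrix.mul_assoc, h, Matrix.mul_one]

end Ctrl

namespace Problem

open Ctrl

variable {n m p : ℕ} (P : Problem n m p) (S : GL (Fin n) ℝ)

lemma Acl_transform (K : Ctrl n m p) :
    P.Acl (K.transform S) = block S * P.Acl K * block S⁻¹ := by
  simp [Acl, block, transform, Ctrl.b, Matrix.fromBlocks_multiply, Matrix.mul_assoc]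

lemma Ehat_transform (V : Ctrl n m p) :
    P.Ehat (V.transform S) = block S * P.Ehat V * block S⁻¹ := by
  simp [Ehat, block, transform, Ctrl.b, Matrix.fromBlocks_multiply, Matrix.mul_assoc]

lemma Bcl_transform (K : Ctrl n m p) : Bcl (K.transform S) = block S * Bcl K := by
  simp [Bcl, block, transform, Matrix.fromBlocks_multiply]

lemma Fhat_transform (V : Ctrl n m p) : Fhat (V.transform S) = block S * Fhat V := by
  simp [Fhat, block, transform, Matrix.fromBlocks_multiply]

lemma Ccl_transform (K : Ctrl n m p) : P.Ccl (K.transform S) = P.Ccl K * block S⁻¹ := by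
  simp [Ccl, block, transform, Matrix.fromBlocks_multiply]

lemma Ghat_transform (V : Ctrl n m p) : Ghat (V.transform S) = Ghat V * block S⁻¹ := by
  simp [Ghat, block, transform, Matrix.fromBlocks_multiply]

lemma Qcl_transform (K : Ctrl n m p) :
    P.Qcl (K.transform S) = (block S⁻¹)ᵀ * P.Qcl K * block S⁻¹ := by
  simp [Qcl, block, transform, Ctrl.c, Matrix.fromBlocks_multiply, Matrix.fromBlocks_transpose,
    Matrix.transpose_mul, Matrix.mul_assoc]

lemma Wcl_transform (K : Ctrl n m p) :
    P.Wcl (K.transform S) = block S * P.Wcl K * (block S)ᵀ := by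
  simp [Wcl, block, transform, Ctrl.b, Matrix.fromBlocks_multiply, Matrix.fromBlocks_transpose,
    Matrix.transpose_mul, Matrix.mul_assoc]

variable {P} {K : Ctrl n m p}

lemma transform_mem_stabilizing (hK : K ∈ P.stabilizing) : K.transform S ∈ P.stabilizing := by
  change Hurwitz _
  rw [Acl_transform]
  exact Hurwitz.conj hK (block_inv_mul S)

lemma trace_transpose_mul_mul_mul {ι : Type*} [Fintype ι] [DecidableEq ι]
    {D D' : Matrix ι ι ℝ} (h : D' * D = 1) (M X : Matrix ι ι ℝ) :
    ((D'ᵀ * M * D') * (D * X * Dᵀ)).trace = (M * X).trace := by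
  have h' : Dᵀ * D'ᵀ = 1 := by rw [← Matrix.transpose_mul, h, Matrix.transpose_one]
  calc ((D'ᵀ * M * D') * (D * X * Dᵀ)).trace = (D'ᵀ * (M * (D' * D) * X * Dᵀ)).trace := by
        simp only [mul_assoc]
    _ = (M * (D' * D) * X * (Dᵀ * D'ᵀ)).trace := by
        rw [Matrix.trace_mul_comm]; simp only [mul_assoc]
    _ = _ := by rw [h, h', mul_one, mul_one]

lemma cost_transform (hK : K ∈ P.stabilizing) : P.cost (K.transform S) = P.cost K := by
  rw [cost, Qcl_transform, Wcl_transform, Acl_transform, Hurwitz.lyap_conj hK (block_inv_mul S),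
    trace_transpose_mul_mul_mul (block_inv_mul S), cost]

lemma Wc_transform (hK : K ∈ P.stabilizing) :
    P.Wc (K.transform S) = block S * P.Wc K * (block S)ᵀ := by
  rw [Wc, Acl_transform, Bcl_transform, Matrix.transpose_mul, Matrix.mul_assoc (block S) (Bcl K),
    ← Matrix.mul_assoc (Bcl K), ← Matrix.mul_assoc (block S) (Bcl K * _), Hurwitz.lyap_conj hK (block_inv_mul S), Wc]

lemma Wo_transform (hK : K ∈ P.stabilizing) :
    P.Wo (K.transform S) = (block S⁻¹)ᵀ * P.Wo K * block S⁻¹ := by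
  have h : (block S)ᵀ * (block S⁻¹)ᵀ = 1 := by
    rw [← Matrix.transpose_mul, block_inv_mul, Matrix.transpose_one]
  have := (Hurwitz.transpose hK).lyap_conj h ((P.Ccl K)ᵀ * P.Ccl K)
  rw [Matrix.transpose_transpose] at this
  rw [Wo, Acl_transform, Ccl_transform, Wo, ← this]
  simp only [Matrix.transpose_mul, Matrix.mul_assoc]

lemma km_transform (hK : K ∈ P.stabilizing) (w₁ w₂ w₃ : ℝ) (U V : Ctrl n m p) :
    P.km w₁ w₂ w₃ (K.transform S) (U.transform S) (V.transform S) = P.km w₁ w₂ w₃ K U V := by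
  have h := block_inv_mul S
  have h' : (block S)ᵀ * (block S⁻¹)ᵀ = 1 := by
    rw [← Matrix.transpose_mul, h, Matrix.transpose_one]
  rw [km, km, Wc_transform S hK, Wo_transform S hK, Ehat_transform, Ehat_transform, Fhat_transform,
    Fhat_transform, Ghat_transform, Ghat_transform]
  generalize block S = D at h h' ⊢
  generalize block S⁻¹ = D' at h h' ⊢
  have t₁ : (D'ᵀ * P.Wo K * D' * (D * P.Ehat U * D') * (D * P.Wc K * Dᵀ)
      * (D * P.Ehat V * D')ᵀ).trace = (P.Wo K * P.Ehat U * P.Wc K * (P.Ehat V)ᵀ).trace := by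
    calc _ = (D'ᵀ * (P.Wo K * (D' * D) * P.Ehat U * (D' * D) * P.Wc K * (Dᵀ * D'ᵀ)
          * (P.Ehat V)ᵀ * Dᵀ)).trace := by
          simp only [Matrix.transpose_mul, mul_assoc]
      _ = (P.Wo K * P.Ehat U * P.Wc K * (P.Ehat V)ᵀ * (Dᵀ * D'ᵀ)).trace := by
          rw [Matrix.trace_mul_comm, h, h', mul_one, mul_one, mul_one, mul_assoc _ Dᵀ, h']
      _ = _ := by rw [h', mul_one]
  have t₂ : (D * Fhat U)ᵀ * (D'ᵀ * P.Wo K * D') * (D * Fhat V) = (Fhat U)ᵀ * P.Wo K * Fhat V := by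
    calc _ = (Fhat U)ᵀ * (Dᵀ * D'ᵀ) * P.Wo K * (D' * D) * Fhat V := by
          simp only [Matrix.transpose_mul, Matrix.mul_assoc]
      _ = _ := by rw [h, h', Matrix.mul_one, Matrix.mul_one]
  have t₃ : Ghat U * D' * (D * P.Wc K * Dᵀ) * (Ghat V * D')ᵀ = Ghat U * P.Wc K * (Ghat V)ᵀ := by
    calc _ = Ghat U * (D' * D) * P.Wc K * (Dᵀ * D'ᵀ) * (Ghat V)ᵀ := by
          simp only [Matrix.transpose_mul, Matrix.mul_assoc]
      _ = _ := by rw [h, h', Matrix.mul_one, Matrix.mul_one]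
  rw [t₁, t₂, t₃]

/-- The cost is known to be invariant only at stabilizing controllers, but the line `K + t V` stays
among them for small `t`. -/
lemma dcost_transform (hK : K ∈ P.stabilizing) (V : Ctrl n m p) :
    P.dcost (K.transform S) (V.transform S) = P.dcost K V := by
  refine Filter.EventuallyEq.deriv_eq ?_
  filter_upwards [P.eventually_stabilizing hK V] with t ht
  rw [← transform_smul, ← transform_add, cost_transform S ht.2]

variable {w₁ w₂ w₃ : ℝ}

lemma MetricPos.transform (h : P.MetricPos w₁ w₂ w₃ K) (hK : K ∈ P.stabilizing) :
    P.MetricPos w₁ w₂ w₃ (K.transform S) := by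
  intro V hV
  rw [← transform_inv_transform S V, km_transform S hK]
  refine h _ fun h0 => hV ?_
  rw [← transform_inv_transform S V, h0]
  simpa using transform_smul S 0 (0 : Ctrl n m p)

/-- The gradient enters only through its pairing with `V`, which is the differential; no
transformation rule for the gradient itself is needed. -/
lemma UpperBound.transform (hP : P.Standard) (hpos : P.MetricPos w₁ w₂ w₃ K)
    (hK : K ∈ P.stabilizing) {L : ℝ} {V : Ctrl n m p} (h : P.UpperBound w₁ w₂ w₃ L K V) :
    P.UpperBound w₁ w₂ w₃ L (K.transform S) (V.transform S) := by
  refine ⟨?_, ?_⟩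
  · rw [← transform_add]
    exact transform_mem_stabilizing S h.1
  · rw [← transform_add, cost_transform S h.1, cost_transform S hK, kmNorm, km_transform S hK,
      (hpos.transform S hK).km_grad hP (transform_mem_stabilizing S hK), dcost_transform S hK,
      ← hpos.km_grad hP hK]
    exact h.2

end Problem

namespace Problem

variable {n m p : ℕ} {P : Problem n m p} {w₁ w₂ w₃ : ℝ}

/-! ### Continuity in the controller -/

section Continuity

lemma continuous_a : Continuous fun K : Ctrl n m p => K.a := continuous_fst

lemma continuous_b : Continuous fun K : Ctrl n m p => K.b := continuous_fst.comp continuous_snd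

lemma continuous_c : Continuous fun K : Ctrl n m p => K.c := continuous_snd.comp continuous_snd

lemma continuous_Acl : Continuous P.Acl :=
  continuous_const.matrix_fromBlocks (continuous_const.matrix_mul continuous_c)
    (continuous_b.matrix_mul continuous_const) continuous_a

lemma continuous_Ehat : Continuous P.Ehat :=
  continuous_const.matrix_fromBlocks (continuous_const.matrix_mul continuous_c)
    (continuous_b.matrix_mul continuous_const) continuous_a

lemma continuous_Bcl : Continuous (Bcl : Ctrl n m p → _) :=
  continuous_const.matrix_fromBlocks continuous_const continuous_const continuous_b

lemma continuous_Fhat : Continuous (Fhat : Ctrl n m p → _) :=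
  continuous_const.matrix_fromBlocks continuous_const continuous_const continuous_b

lemma continuous_Ccl : Continuous P.Ccl :=
  continuous_const.matrix_fromBlocks continuous_const continuous_const continuous_c

lemma continuous_Ghat : Continuous (Ghat : Ctrl n m p → _) :=
  continuous_const.matrix_fromBlocks continuous_const continuous_const continuous_c

lemma continuous_Qcl : Continuous P.Qcl :=
  continuous_const.matrix_fromBlocks continuous_const continuous_const
    ((continuous_c.matrix_transpose.matrix_mul continuous_const).matrix_mul continuous_c)

lemma continuous_Wcl : Continuous P.Wcl :=
  continuous_const.matrix_fromBlocks continuous_const continuous_const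
    ((continuous_b.matrix_mul continuous_const).matrix_mul continuous_b.matrix_transpose)

lemma continuous_dQcl (V : Ctrl n m p) : Continuous fun K => P.dQcl K V :=
  continuous_const.matrix_fromBlocks continuous_const continuous_const
    (((continuous_c.matrix_transpose.matrix_mul continuous_const).matrix_mul continuous_const).add
      (continuous_const.matrix_mul continuous_c))

lemma continuous_dWcl (V : Ctrl n m p) : Continuous fun K => P.dWcl K V :=
  continuous_const.matrix_fromBlocks continuous_const continuous_const
    (((continuous_b.matrix_mul continuous_const).matrix_mul continuous_const).add
      (continuous_const.matrix_mul continuous_b.matrix_transpose))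

lemma continuousOn_Wc : ContinuousOn P.Wc P.stabilizing := fun _ hK =>
  Hurwitz.tendsto_lyap hK continuous_Acl.continuousWithinAt
    (continuous_Bcl.matrix_mul continuous_Bcl.matrix_transpose).continuousWithinAt
    (by simp [Matrix.IsSymm, Matrix.transpose_mul])
    (fun _ => by simp [Matrix.IsSymm, Matrix.transpose_mul])

lemma continuousOn_Wo : ContinuousOn P.Wo P.stabilizing := fun _ hK =>
  Hurwitz.tendsto_lyap (Hurwitz.transpose hK) continuous_Acl.matrix_transpose.continuousWithinAt
    (continuous_Ccl.matrix_transpose.matrix_mul continuous_Ccl).continuousWithinAt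
    (by simp [Matrix.IsSymm, Matrix.transpose_mul])
    (fun _ => by simp [Matrix.IsSymm, Matrix.transpose_mul])

lemma continuousOn_lyap_one : ContinuousOn (fun K => lyap (P.Acl K) 1) P.stabilizing := fun _ hK =>
  Hurwitz.tendsto_lyap hK continuous_Acl.continuousWithinAt continuousWithinAt_const
    Matrix.transpose_one (fun _ => Matrix.transpose_one)

lemma continuousOn_covariance (hP : P.Standard) : ContinuousOn P.covariance P.stabilizing :=
  fun K hK => Hurwitz.tendsto_lyap hK continuous_Acl.continuousWithinAt
    continuous_Wcl.continuousWithinAt (Wcl_isSymm hP K) (Wcl_isSymm hP)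

lemma continuousOn_covarianceSource (hP : P.Standard) (V : Ctrl n m p) :
    ContinuousOn (fun K => P.covarianceSource K V) P.stabilizing :=
  (continuous_dWcl V).continuousOn.add
    ((continuousOn_const.mul (continuousOn_covariance hP)).add
      ((continuousOn_covariance hP).mul continuousOn_const))

lemma continuousOn_costDeriv (hP : P.Standard) (V : Ctrl n m p) :
    ContinuousOn (fun K => P.costDeriv K V) P.stabilizing := by
  have h : ContinuousOn (fun K => lyap (P.Acl K) (P.covarianceSource K V)) P.stabilizing := by
    intro K hK
    have hg := continuousOn_covarianceSource hP V K hK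
    -- `Hurwitz.tendsto_lyap` asks for symmetry at every point, which is available only on
    -- stabilizing controllers; hence the passage to the subtype.
    have h1 : Tendsto (fun K' : P.stabilizing => lyap (P.Acl K') (P.covarianceSource K' V))
        (𝓝 ⟨K, hK⟩) (𝓝 (lyap (P.Acl K) (P.covarianceSource K V))) :=
      Hurwitz.tendsto_lyap hK (continuous_Acl.continuousAt.comp continuous_subtype_val.continuousAt)
        ((continuousOn_covarianceSource hP V).domRestrict.tendsto ⟨K, hK⟩)
        (covarianceSource_isSymm hP hK V) (fun K' => covarianceSource_isSymm hP K'.2 V)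
    exact (continuousWithinAt_iff_continuousAt_domRestrict _ hK).2 h1
  have htr : Continuous fun M : Matrix (Fin n ⊕ Fin n) (Fin n ⊕ Fin n) ℝ => M.trace :=
    continuous_id.matrix_trace
  exact (htr.comp_continuousOn ((continuous_dQcl V).continuousOn.mul
      (continuousOn_covariance hP))).add
    (htr.comp_continuousOn (continuous_Qcl.continuousOn.mul h))

lemma continuousOn_km {X : Type*} [TopologicalSpace X] {s : Set X} {k u v : X → Ctrl n m p}
    (hk : ContinuousOn k s) (hks : ∀ x ∈ s, k x ∈ P.stabilizing) (hu : ContinuousOn u s)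
    (hv : ContinuousOn v s) : ContinuousOn (fun x => P.km w₁ w₂ w₃ (k x) (u x) (v x)) s := by
  have hWc := continuousOn_Wc.comp hk hks
  have hWo := continuousOn_Wo.comp hk hks
  have hEu := (continuous_Ehat (P := P)).comp_continuousOn hu
  have hEv := (continuous_Ehat (P := P)).comp_continuousOn hv
  have hFu := continuous_Fhat.comp_continuousOn hu
  have hFv := continuous_Fhat.comp_continuousOn hv
  have hGu := continuous_Ghat.comp_continuousOn hu
  have hGv := continuous_Ghat.comp_continuousOn hv
  rw [continuousOn_iff_continuous_domRestrict] at *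
  exact ((continuous_const.mul
      (((hWo.matrix_mul hEu).matrix_mul hWc).matrix_mul hEv.matrix_transpose).matrix_trace).add
    (continuous_const.mul
      ((hFu.matrix_transpose.matrix_mul hWo).matrix_mul hFv).matrix_trace)).add
    (continuous_const.mul ((hGu.matrix_mul hWc).matrix_mul hGv.matrix_transpose).matrix_trace)

lemma continuousOn_grad (hP : P.Standard) {s : Set (Ctrl n m p)} (hs : s ⊆ P.stabilizing)
    (hpos : ∀ K ∈ s, P.MetricPos w₁ w₂ w₃ K) : ContinuousOn (P.grad w₁ w₂ w₃) s := by
  have hG : ContinuousOn (P.gram w₁ w₂ w₃) s := by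
    refine continuousOn_pi.2 fun i => continuousOn_pi.2 fun j => ?_
    exact continuousOn_km continuousOn_id hs continuousOn_const continuousOn_const
  have hGinv : ContinuousOn (fun K => (P.gram w₁ w₂ w₃ K)⁻¹) s := by
    simp only [Matrix.inv_def, Ring.inverse_eq_inv']
    have hdet : Continuous fun M : Matrix (Fin (Module.finrank ℝ (Ctrl n m p)))
        (Fin (Module.finrank ℝ (Ctrl n m p))) ℝ => M.det := continuous_id.matrix_det
    have hadj : Continuous fun M : Matrix (Fin (Module.finrank ℝ (Ctrl n m p)))
        (Fin (Module.finrank ℝ (Ctrl n m p))) ℝ => M.adjugate := continuous_id.matrix_adjugate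
    exact ((hdet.comp_continuousOn hG).inv₀ fun K hK => (hpos K hK).det_gram_ne_zero).smul
      (hadj.comp_continuousOn hG)
  have hd : ∀ V, ContinuousOn (fun K => P.dcost K V) s := fun V =>
    ((continuousOn_costDeriv hP V).mono hs).congr fun K hK => dcost_eq P hP (hs hK) V
  exact continuousOn_finsetSum _ fun i _ => continuousOn_finsetSum _ fun j _ =>
    ((continuousOn_pi.1 (continuousOn_pi.1 hGinv i) j).mul (hd _)).smul continuousOn_const

end Continuity

/-! ### The stability certificate -/

section Certificate

open scoped Matrix.Norms.L2Operator

lemma kmNorm_smul {t : ℝ} (ht : 0 ≤ t) (K V : Ctrl n m p) :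
    P.kmNorm w₁ w₂ w₃ K (t • V) = t * P.kmNorm w₁ w₂ w₃ K V := by
  rw [kmNorm, kmNorm, ← kmBilin_apply, map_smul, map_smul, LinearMap.smul_apply, smul_smul,
    smul_eq_mul, kmBilin_apply, Real.sqrt_mul (mul_nonneg ht ht), Real.sqrt_mul_self ht]

lemma MetricPos.kmNorm_pos {K V : Ctrl n m p} (h : P.MetricPos w₁ w₂ w₃ K) (hV : V ≠ 0) :
    0 < P.kmNorm w₁ w₂ w₃ K V := Real.sqrt_pos.2 (h V hV)

lemma MetricPos.kmNorm_sq {K : Ctrl n m p} (h : P.MetricPos w₁ w₂ w₃ K) (V : Ctrl n m p) :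
    P.kmNorm w₁ w₂ w₃ K V ^ 2 = P.km w₁ w₂ w₃ K V V := by
  refine Real.sq_sqrt ?_
  rcases eq_or_ne V 0 with rfl | hV
  · rw [← kmBilin_apply, map_zero]
  · exact (h V hV).le

lemma cert_eq (hn : 1 ≤ n) {K : Ctrl n m p} (hK : K ∈ P.stabilizing) (V : Ctrl n m p) :
    P.cert K V = (ENNReal.ofReal (2 * ‖P.Ehat V‖ * ‖lyap (P.Acl K) 1‖))⁻¹ := by
  have : Nonempty (Fin n ⊕ Fin n) := ⟨Sum.inl ⟨0, hn⟩⟩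
  rw [cert, lambdaMax, sSup_spectrum_eq_norm (Hurwitz.lyap_posSemidef hK Matrix.PosSemidef.one),
    ENNReal.ofReal_mul (by positivity), ENNReal.ofReal_mul (by positivity), ENNReal.ofReal_ofNat,
    ← ofReal_norm, Matrix.l2_opNorm_toEuclideanCLM]

/-- Test the infimum defining `σ(K)` at `U / ‖U‖_K` and clear denominators. The choice `U = V` gives
the smallness of the perturbation; a fixed `U` with `Ê(U) ≠ 0` bounds the length of `V`. -/
lemma MetricPos.norm_Ehat_mul_le (hn : 1 ≤ n) {K V : Ctrl n m p} (h : P.MetricPos w₁ w₂ w₃ K)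
    (hK : K ∈ P.stabilizing) {θ : ℝ} (hθ : 0 ≤ θ)
    (hV : ENNReal.ofReal (P.kmNorm w₁ w₂ w₃ K V)
      ≤ ENNReal.ofReal θ * P.certRadius w₁ w₂ w₃ K) (U : Ctrl n m p) :
    2 * ‖P.Ehat U‖ * ‖lyap (P.Acl K) 1‖ * P.kmNorm w₁ w₂ w₃ K V
      ≤ θ * P.kmNorm w₁ w₂ w₃ K U := by
  have hrhs : 0 ≤ θ * P.kmNorm w₁ w₂ w₃ K U := mul_nonneg hθ (Real.sqrt_nonneg _)
  rcases eq_or_ne U 0 with rfl | hU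
  · have : P.Ehat (0 : Ctrl n m p) = 0 := by simpa using P.Ehat_smul 0 (0 : Ctrl n m p)
    rw [this, norm_zero, mul_zero, zero_mul, zero_mul]
    exact hrhs
  have hk := h.kmNorm_pos hU
  set k := P.kmNorm w₁ w₂ w₃ K U
  set π := ‖lyap (P.Acl K) 1‖
  have h1 : P.kmNorm w₁ w₂ w₃ K (k⁻¹ • U) = 1 := by
    rw [kmNorm_smul (inv_nonneg.2 hk.le), inv_mul_cancel₀ hk.ne']
  have h2 : P.certRadius w₁ w₂ w₃ K ≤ P.cert K (k⁻¹ • U) := iInf₂_le (k⁻¹ • U) h1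
  have h3 : 2 * ‖P.Ehat (k⁻¹ • U)‖ * π = 2 * ‖P.Ehat U‖ * π / k := by
    rw [Ehat_smul, norm_smul, Real.norm_of_nonneg (inv_nonneg.2 hk.le)]
    field_simp
  rw [cert_eq hn hK, h3] at h2
  rcases (show 0 ≤ 2 * ‖P.Ehat U‖ * π by positivity).eq_or_lt with h0 | h0
  · rw [← h0, zero_mul]
    exact hrhs
  have h4 := hV.trans (mul_le_mul_right h2 _)
  rw [← ENNReal.ofReal_inv_of_pos (by positivity), ← ENNReal.ofReal_mul hθ,
    ENNReal.ofReal_le_ofReal_iff (by positivity), inv_div] at h4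
  calc _ ≤ 2 * ‖P.Ehat U‖ * π * (θ * (k / (2 * ‖P.Ehat U‖ * π))) := by gcongr
    _ = θ * k := by
        generalize 2 * ‖P.Ehat U‖ * π = a at h0
        field_simp

lemma MetricPos.norm_Ehat_le (hn : 1 ≤ n) {K V : Ctrl n m p} (h : P.MetricPos w₁ w₂ w₃ K)
    (hK : K ∈ P.stabilizing) {θ : ℝ} (hθ : 0 ≤ θ)
    (hV : ENNReal.ofReal (P.kmNorm w₁ w₂ w₃ K V)
      ≤ ENNReal.ofReal θ * P.certRadius w₁ w₂ w₃ K) :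
    2 * ‖P.Ehat V‖ * ‖lyap (P.Acl K) 1‖ ≤ θ := by
  rcases eq_or_ne V 0 with rfl | hV0
  · have : P.Ehat (0 : Ctrl n m p) = 0 := by simpa using P.Ehat_smul 0 (0 : Ctrl n m p)
    rw [this, norm_zero, mul_zero, zero_mul]
    exact hθ
  · exact le_of_mul_le_mul_right (h.norm_Ehat_mul_le hn hK hθ hV V) (h.kmNorm_pos hV0)

/-! ### Uniform bounds over a compact set of controllers -/

/-- The metric is continuous and positive on the compact product of `𝒦` with the unit sphere;
homogeneity does the rest. -/
lemma exists_km_ge {𝒦 : Set (Ctrl n m p)} (h𝒦 : IsCompact 𝒦) (hs : 𝒦 ⊆ P.stabilizing)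
    (hpos : ∀ K ∈ 𝒦, P.MetricPos w₁ w₂ w₃ K) :
    ∃ c : ℝ, 0 < c ∧ ∀ K ∈ 𝒦, ∀ V : Ctrl n m p, c * ‖V‖ ^ 2 ≤ P.km w₁ w₂ w₃ K V V := by
  have : ProperSpace (Ctrl n m p) := FiniteDimensional.proper ℝ _
  have hcomp : IsCompact (𝒦 ×ˢ Metric.sphere (0 : Ctrl n m p) 1) := h𝒦.prod (isCompact_sphere _ _)
  obtain ⟨c, hc, hle⟩ := hcomp.exists_forall_le' (a := 0)
    (f := fun x : Ctrl n m p × Ctrl n m p => P.km w₁ w₂ w₃ x.1 x.2 x.2)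
    (continuousOn_km continuousOn_fst (fun x hx => hs hx.1) continuousOn_snd continuousOn_snd)
    (fun x hx => hpos x.1 hx.1 x.2 (ne_zero_of_mem_unit_sphere ⟨x.2, hx.2⟩))
  refine ⟨c, hc, fun K hK V => ?_⟩
  rcases eq_or_ne V 0 with rfl | hV
  · rw [← kmBilin_apply, map_zero, norm_zero]
    simp
  have hVn : 0 < ‖V‖ := norm_pos_iff.2 hV
  have hmem : (K, ‖V‖⁻¹ • V) ∈ 𝒦 ×ˢ Metric.sphere (0 : Ctrl n m p) 1 := by
    refine ⟨hK, ?_⟩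
    rw [mem_sphere_zero_iff_norm, norm_smul, norm_inv, norm_norm, inv_mul_cancel₀ hVn.ne']
  have h1 := hle _ hmem
  simp only [← kmBilin_apply, map_smul, LinearMap.smul_apply, smul_eq_mul] at h1
  rw [kmBilin_apply] at h1
  calc c * ‖V‖ ^ 2 ≤ ‖V‖⁻¹ * (‖V‖⁻¹ * P.km w₁ w₂ w₃ K V V) * ‖V‖ ^ 2 := by gcongr
    _ = P.km w₁ w₂ w₃ K V V := by field_simp

lemma lyap_one_ne_zero (hn : 1 ≤ n) {K : Ctrl n m p} (hK : K ∈ P.stabilizing) :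
    lyap (P.Acl K) 1 ≠ 0 := by
  have : Nonempty (Fin n ⊕ Fin n) := ⟨Sum.inl ⟨0, hn⟩⟩
  intro h0
  have h := Hurwitz.lyap_spec hK 1
  rw [h0, mul_zero, zero_mul, add_zero] at h
  exact one_ne_zero (neg_eq_zero.1 h.symm)

lemma exists_upperBound (hn : 1 ≤ n) (hP : P.Standard) {𝒦 : Set (Ctrl n m p)} (h𝒦 : IsCompact 𝒦)
    (hs : 𝒦 ⊆ P.stabilizing) (hpos : ∀ K ∈ 𝒦, P.MetricPos w₁ w₂ w₃ K) {θ : ℝ} (hθ0 : 0 ≤ θ)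
    (hθ : θ < 1) :
    ∃ L : ℝ, 0 < L ∧ ∀ K ∈ 𝒦, ∀ V : Ctrl n m p, ENNReal.ofReal (P.kmNorm w₁ w₂ w₃ K V)
      ≤ ENNReal.ofReal θ * P.certRadius w₁ w₂ w₃ K → P.UpperBound w₁ w₂ w₃ L K V := by
  have : Nonempty (Fin n) := ⟨⟨0, hn⟩⟩
  obtain ⟨c, hc, hkm⟩ := exists_km_ge h𝒦 hs hpos
  have hcπ : ContinuousOn (fun K => ‖lyap (P.Acl K) 1‖) 𝒦 := (continuousOn_lyap_one.mono hs).norm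
  obtain ⟨δ, hδ, hδle⟩ := h𝒦.exists_forall_le' hcπ (a := 0)
    (fun K hK => norm_pos_iff.2 (lyap_one_ne_zero hn (hs hK)))
  obtain ⟨Λ, hΛ⟩ := h𝒦.exists_bound_of_continuousOn hcπ
  obtain ⟨M₀, hM₀⟩ := h𝒦.exists_bound_of_continuousOn continuousOn_id
  -- A fixed direction with `Ê(U) ≠ 0`: it keeps `σ` bounded above on `𝒦`, so admissible `V` satisfy
  -- `‖V‖_K ≤ T`.
  set U : Ctrl n m p := (1, 0, 0) with hU
  obtain ⟨u, hu⟩ := h𝒦.exists_bound_of_continuousOn (f := fun K => P.kmNorm w₁ w₂ w₃ K U)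
    (Real.continuous_sqrt.comp_continuousOn
      (continuousOn_km continuousOn_id hs continuousOn_const continuousOn_const))
  have hEU : 0 < ‖P.Ehat U‖ := by
    rw [norm_pos_iff]
    intro h0
    rw [Ehat, ← Matrix.fromBlocks_zero, Matrix.fromBlocks_inj] at h0
    exact one_ne_zero h0.2.2.2
  obtain ⟨T, hT⟩ : ∃ T : ℝ, T = θ * u / (2 * ‖P.Ehat U‖ * δ) := ⟨_, rfl⟩
  obtain ⟨M, hM⟩ : ∃ M : ℝ, M = max 0 (max M₀ (max Λ (T / √c))) := ⟨_, rfl⟩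
  have hM0 : 0 ≤ M := hM ▸ le_max_left _ _
  have hM1 : M₀ ≤ M := hM ▸ (le_max_left _ _).trans (le_max_right _ _)
  have hM2 : Λ ≤ M := hM ▸ ((le_max_left _ _).trans (le_max_right _ _)).trans (le_max_right _ _)
  have hM3 : T / √c ≤ M :=
    hM ▸ ((le_max_right _ _).trans (le_max_right _ _)).trans (le_max_right _ _)
  obtain ⟨C, hC0, hC⟩ := P.exists_cost_remainder_bound hP hM0 hθ
  -- `C ‖V‖² ≤ (C / c) ‖V‖_K²` explains `2 C / c`; the extra `1` only makes the constant positive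
  -- when `C = 0`.
  refine ⟨2 * C / c + 1, by positivity, fun K hK V hV => ?_⟩
  have hpK := hpos K hK
  have hKs := hs hK
  have hsq := hpK.kmNorm_sq V
  have hkmV := hkm K hK V
  have hVT : P.kmNorm w₁ w₂ w₃ K V ≤ T := by
    have h1 := hpK.norm_Ehat_mul_le hn hKs hθ0 hV U
    have h2 : P.kmNorm w₁ w₂ w₃ K U ≤ u := (le_abs_self _).trans (hu K hK)
    rw [hT, le_div_iff₀ (by positivity), mul_comm]
    calc _ ≤ 2 * ‖P.Ehat U‖ * ‖lyap (P.Acl K) 1‖ * P.kmNorm w₁ w₂ w₃ K V := by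
          have := Real.sqrt_nonneg (P.km w₁ w₂ w₃ K V V)
          have := hδle K hK
          rw [kmNorm]
          gcongr
      _ ≤ θ * u := h1.trans (by gcongr)
  have hVM : ‖V‖ ≤ M := by
    refine le_trans ?_ hM3
    rw [le_div_iff₀ (Real.sqrt_pos.2 hc)]
    refine le_trans ?_ hVT
    refine Real.le_sqrt_of_sq_le ?_
    rw [mul_pow, Real.sq_sqrt hc.le]
    linarith
  obtain ⟨hst, hrem⟩ := hC K hKs V ((hM₀ K hK).trans hM1) hVM
    ((le_abs_self _).trans ((hΛ K hK).trans hM2)) (hpK.norm_Ehat_le hn hKs hθ0 hV)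
  refine ⟨hst, ?_⟩
  rw [hpK.km_grad hP hKs, dcost_eq P hP hKs, hsq]
  have h1 := (le_abs_self _).trans hrem
  have h2 : C * ‖V‖ ^ 2 ≤ C / c * P.km w₁ w₂ w₃ K V V := by
    rw [div_mul_eq_mul_div, le_div_iff₀ hc]
    nlinarith
  have h3 : 0 ≤ P.km w₁ w₂ w₃ K V V := hsq ▸ sq_nonneg _
  have h4 : (2 * C / c + 1) / 2 * P.km w₁ w₂ w₃ K V V
      = C / c * P.km w₁ w₂ w₃ K V V + P.km w₁ w₂ w₃ K V V / 2 := by ring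
  linarith

/-- If the gradient norm were at most `1/2`, the factor multiplying `σ` would be at least one, being
`∞` for zero gradient. -/
lemma half_lt_kmNorm_grad {K : Ctrl n m p}
    (h : P.gradRadius w₁ w₂ w₃ K < P.certRadius w₁ w₂ w₃ K) :
    1 / 2 < P.kmNorm w₁ w₂ w₃ K (P.grad w₁ w₂ w₃ K) := by
  by_contra! hle
  refine h.not_ge ?_
  have h1 : (1 : ℝ≥0∞) ≤ 2⁻¹ *
      (ENNReal.ofReal (P.kmNorm w₁ w₂ w₃ K (P.grad w₁ w₂ w₃ K)))⁻¹ := by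
    calc (1 : ℝ≥0∞) = 2⁻¹ * (ENNReal.ofReal (1 / 2))⁻¹ := by
          rw [one_div, ENNReal.ofReal_inv_of_pos two_pos, ENNReal.ofReal_ofNat, inv_inv,
            ENNReal.inv_mul_cancel (by norm_num) (by norm_num)]
      _ ≤ _ := by gcongr
  calc P.certRadius w₁ w₂ w₃ K = 1 * P.certRadius w₁ w₂ w₃ K := (one_mul _).symm
    _ ≤ _ := by rw [gradRadius]; gcongr

lemma gradRadius_le {K : Ctrl n m p} {g : ℝ} (hg : 0 < g)
    (h : g ≤ P.kmNorm w₁ w₂ w₃ K (P.grad w₁ w₂ w₃ K)) :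
    P.gradRadius w₁ w₂ w₃ K ≤ ENNReal.ofReal (2⁻¹ * g⁻¹) * P.certRadius w₁ w₂ w₃ K := by
  rw [gradRadius, ENNReal.ofReal_mul (by norm_num), ENNReal.ofReal_inv_of_pos two_pos,
    ENNReal.ofReal_inv_of_pos hg, ENNReal.ofReal_ofNat]
  gcongr

end Certificate

end Problem
end LQG
end

/-! ### The descent bound on orbits -/

open LQG LQG.Problem in
theorem mainTheorem9 {n m p : ℕ} (hn : 1 ≤ n) (P : LQG.Problem n m p) (hP : P.Standard)
    (w₁ w₂ w₃ : ℝ) (hw₁ : 0 < w₁) (hw₂ : 0 ≤ w₂) (hw₃ : 0 ≤ w₃)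
    (hC : 0 < w₂ ∨ P.C.rank = p) (hB : 0 < w₃ ∨ P.B.rank = m)
    (𝒦 : Set (LQG.Ctrl n m p)) (h𝒦 : IsCompact 𝒦) (h𝒦min : 𝒦 ⊆ P.minimal) :
    (∃ L : ℝ, 0 < L ∧
      ∀ KV ∈ LQG.Problem.orbit
          (P.tube w₁ w₂ w₃ 𝒦 (fun K => 2⁻¹ * P.certRadius w₁ w₂ w₃ K)),
        P.UpperBound w₁ w₂ w₃ L KV.1 KV.2) ∧
    ((∀ K ∈ 𝒦, P.gradRadius w₁ w₂ w₃ K < P.certRadius w₁ w₂ w₃ K) →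
      ∃ L : ℝ, 0 < L ∧
        ∀ KV ∈ LQG.Problem.orbit (P.tube w₁ w₂ w₃ 𝒦 (P.gradRadius w₁ w₂ w₃)),
          P.UpperBound w₁ w₂ w₃ L KV.1 KV.2) := by
  have hs : 𝒦 ⊆ P.stabilizing := fun K hK => (h𝒦min hK).1
  have hpos : ∀ K ∈ 𝒦, P.MetricPos w₁ w₂ w₃ K := fun K hK V hV =>
    P.km_pos hP hw₁ hw₂ hw₃ hC hB (h𝒦min hK) hV
  -- Both radii are of the form `ρ ≤ θ σ` with a single `θ < 1` valid on all of `𝒦`.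
  have key : ∀ θ : ℝ, 0 ≤ θ → θ < 1 → ∀ ρ : LQG.Ctrl n m p → ENNReal,
      (∀ K ∈ 𝒦, ρ K ≤ ENNReal.ofReal θ * P.certRadius w₁ w₂ w₃ K) →
      ∃ L : ℝ, 0 < L ∧ ∀ KV ∈ LQG.Problem.orbit (P.tube w₁ w₂ w₃ 𝒦 ρ),
        P.UpperBound w₁ w₂ w₃ L KV.1 KV.2 := by
    intro θ hθ0 hθ ρ hρ
    obtain ⟨L, hL, h⟩ := exists_upperBound hn hP h𝒦 hs hpos hθ0 hθ
    refine ⟨L, hL, ?_⟩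
    rintro _ ⟨S, ⟨K, V⟩, ⟨hK, hV⟩, rfl⟩
    exact (h K hK V (hV.trans (hρ K hK))).transform S hP (hpos K hK) (hs hK)
  refine ⟨key 2⁻¹ (by norm_num) (by norm_num) _ fun K _ => ?_, fun hlt => ?_⟩
  · rw [ENNReal.ofReal_inv_of_pos two_pos, ENNReal.ofReal_ofNat]
  -- The pointwise inequality gives no uniform `θ` by itself; continuity of the gradient norm on `𝒦`
  -- yields a lower bound `g > 1/2`, and `θ = 1 / (2g)`.
  · obtain ⟨g, hg, hgle⟩ := h𝒦.exists_forall_le' (a := 1 / 2)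
      (f := fun K => P.kmNorm w₁ w₂ w₃ K (P.grad w₁ w₂ w₃ K))
      (Real.continuous_sqrt.comp_continuousOn (continuousOn_km continuousOn_id hs
        (continuousOn_grad hP hs hpos) (continuousOn_grad hP hs hpos)))
      (fun K hK => half_lt_kmNorm_grad (hlt K hK))
    have hg0 : 0 < g := by linarith
    refine key (2⁻¹ * g⁻¹) (by positivity) ?_ _ fun K hK => gradRadius_le hg0 (hgle K hK)
    rw [← mul_inv]
    exact inv_lt_one_of_one_lt₀ (by linarith)
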